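/- **Theorem (Bootstrapping).** *Conventions.* Graphs are finite undirected multigraphs on a fixed set of $n$ vertices, with capacities $u(e)>0$ and lengths $\ell(e)>0$. A flow $F$ assigns a value $F(P)\ge 0$ to every simple path $P$; its flow-paths are the $P$ with $F(P)>0$, their number is the path count, $\mathrm{leng}_F$ and $\mathrm{step}_F$ are the maximum length and the maximum number of edges of a flow-path, $D_F(v,w)$ is the total value on $(v,w)$-paths, and the congestion of $F$ is $\max_e F(e)/u(e)$ with $F(e)=\sum_{P\ni e}F(P)$. An embedding of $H$ into $G$ is a flow $\Pi=\sum_{e\in E(H)}f_e$ in $G$, where $f_e$ for $e=\{v,w\}$ is a $(v,w)$-flow of value $u_H(e)$; it has length slack $s$ if $\mathrm{leng}_{f_e}\le s\,\ell_H(e)$ for all $e$. $G'$ is an $h$-length-constrained $t$-step emulator of $G$ with length slack $s$ and congestion slack $\kappa$ if (a) every edge of $G'$ has length $sh$; (b) for every flow $F$ in $G$ with $\mathrm{leng}_F\le h$ there is a flow $F'$ in $G'$ with $D_{F'}=D_F$, congestion at most $\kappa$ times that of $F$, and $\mathrm{step}_{F'}\le t$; (c) $G'$ embeds into $G$ with congestion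 at most $1$ and length slack $1$. Algorithms are programs for a vector random access machine with unit-cost arithmetic: a vector instruction has work linear in the size of its operands and result, and depth $1$ (logarithmic for prefix sums and packing); a call of a given subroutine writes its result to memory and costs $1$. An output emulator is represented by its list of ends and capacities together with the common length of its edges. *Statement.* Let $h,d,t$ be natural numbers, and suppose there are $\alpha>1$, $s,\kappa\ge 0$ and an algorithm $\mathcal A$ that, given a graph $H$ (on $n$ vertices, with integral lengths) and an integer $1\le h'\le(2t+3)h$, computes an $h'$-length-constrained $t$-step emulator $H'$ of $H$ with length slack $s$, congestion slack $\kappa$ and $|E(H')|\le\alpha|E(H)|$, such that $H'$ has an embedding into $H$ with congestion at most $1$, length slack $1$ and path count at most $\alpha|E(H)|$. Then there is an algorithm that, given a graph $G$ with $n$ vertices, $m$ edges and integral lengths, and the parameters $(h,d,t,h_0)$ with $1\le h_0\le h$ and $s$, computes graphs $G'_0,\dots,G'_d$ such that for each $0\le i\le d$, with $G'_{-1}=\emptyset$: 1. $G'_i$ is an $h_0h^i$-length-constrained $t$-step emulator of $G$ with length slack $s^{i+1}(2t+3)^i$ and congestion slack $(2\kappa)^{i+1}$. 2. $G'_i$ has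 at most $(2\alpha)^{i+1}m$ edges. 3. There is an embedding of $G'_i$ into $G\cup G'_{i-1}$ with length slack $1$, congestion at most $1$, path count at most $(2\alpha)^{i+1}m$ and maximum step at most $(2st+3s)h$. It only routes through edges of $G$ with length in the range $(h_0h^{i-1},h_0h^i]$ if $i\ge1$, and through edges of $G$ with length at most $h_0$ if $i=0$. The algorithm calls $\mathcal A$ on $d+1$ graphs (all with integral lengths and a length parameter in $[1,(2t+3)h]$), each with $O((d+1)(2\alpha)^d m)$ edges, and outside these calls it has $O((d+1)(2\alpha)^d(m+1))$ work and $\tilde O(d+1)$ depth, where $\tilde O$ hides factors polylogarithmic in $m+2$. The program and the constants hidden in the $O$-notation are absolute: they depend on none of $n,h,d,t,h_0,s,\kappa,\alpha,\mathcal A,G$. -/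

import Mathlib

open scoped NNReal

noncomputable section

namespace LowStep

/-! ### Capacitated graphs with edge lengths -/

/-- A finite undirected multigraph on the vertex set `Fin n` (parallel edges and self-loops are
allowed) with `m` edges, positive edge capacities and positive edge lengths. The order of the two
ends `src e`, `dst e` of an edge is only bookkeeping. -/
structure CapGraph (n : ℕ) where
  /-- the number of edges -/
  m : ℕ
  src : Fin m → Fin n
  dst : Fin m → Fin n
  cap : Fin m → ℝ≥0
  len : Fin m → ℝ≥0
  cap_pos : ∀ e, 0 < cap e
  len_pos : ∀ e, 0 < len e

namespace CapGraph

variable {n : ℕ}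

/-- All edge lengths are (positive) integers. -/
def Integral (G : CapGraph n) : Prop :=
  ∀ e, ∃ k : ℕ, G.len e = k

/-- The graph without edges. -/
def empty (n : ℕ) : CapGraph n where
  m := 0
  src := Fin.elim0
  dst := Fin.elim0
  cap := Fin.elim0
  len := Fin.elim0
  cap_pos := fun e => e.elim0
  len_pos := fun e => e.elim0

/-- The union `G ∪ H`: the edges of `G` followed by the edges of `H`, as a disjoint union of edge
sets over the common vertex set. -/
def union (G H : CapGraph n) : CapGraph n where
  m := G.m + H.m
  src := Fin.append G.src H.src
  dst := Fin.append G.dst H.dst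
  cap := Fin.append G.cap H.cap
  len := Fin.append G.len H.len
  cap_pos := fun e => by
    refine Fin.addCases (fun i => ?_) (fun i => ?_) e
    · simpa using G.cap_pos i
    · simpa using H.cap_pos i
  len_pos := fun e => by
    refine Fin.addCases (fun i => ?_) (fun i => ?_) e
    · simpa using G.len_pos i
    · simpa using H.len_pos i

/-- The starting vertex of a traversed edge; `true` means from `src` to `dst`, `false` means from
`dst` to `src`. -/
def tail (G : CapGraph n) (a : Fin G.m × Bool) : Fin n :=
  if a.2 then G.src a.1 else G.dst a.1

/-- The final vertex of a traversed edge. -/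
def head (G : CapGraph n) (a : Fin G.m × Bool) : Fin n :=
  if a.2 then G.dst a.1 else G.src a.1

/-- The list of traversed edges is a walk from `v` to `w`. -/
def IsWalk (G : CapGraph n) : Fin n → Fin n → List (Fin G.m × Bool) → Prop
  | v, w, [] => v = w
  | v, w, a :: l => G.tail a = v ∧ G.IsWalk (G.head a) w l

end CapGraph

/-! ### Simple paths and multicommodity flows -/

/-- A simple path of `G`, from `first` to `last`: no vertex is repeated. The path without edges
at a vertex is included. -/
structure SimplePath {n : ℕ} (G : CapGraph n) where
  first : Fin n
  last : Fin n
  darts : List (Fin G.m × Bool)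
  isWalk : G.IsWalk first last darts
  nodup : (first :: darts.map G.head).Nodup

namespace SimplePath

variable {n : ℕ} {G : CapGraph n}

/-- The length of a path: the sum of the lengths of its edges. -/
def length (P : SimplePath G) : ℝ≥0 := (P.darts.map fun a => G.len a.1).sum

/-- The step-length of a path: the number of its edges. -/
def steps (P : SimplePath G) : ℕ := P.darts.length

/-- The path goes through the edge `e`, in either direction. -/
def Uses (P : SimplePath G) (e : Fin G.m) : Prop := e ∈ P.darts.map Prod.fst

end SimplePath

/-- A multicommodity flow: a nonnegative value for every simple path (a finite graph has only
finitely many simple paths, so finite support is no restriction). -/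
abbrev MFlow {n : ℕ} (G : CapGraph n) : Type := SimplePath G →₀ ℝ≥0

namespace MFlow

variable {n : ℕ} {G : CapGraph n}

/-- The total value of a flow. -/
def val (F : MFlow G) : ℝ≥0 := ∑ P ∈ F.support, F P

open Classical in
/-- The total flow through the edge `e`. -/
def onEdge (F : MFlow G) (e : Fin G.m) : ℝ≥0 := ∑ P ∈ F.support with P.Uses e, F P

/-- The demand routed by `F`. -/
def demand (F : MFlow G) (v w : Fin n) : ℝ≥0 :=
  ∑ P ∈ F.support with (P.first = v ∧ P.last = w), F P

/-- The congestion: the maximum over all edges of flow divided by capacity. -/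
def congestion (F : MFlow G) : ℝ≥0 := Finset.univ.sup fun e => F.onEdge e / G.cap e

/-- The length of a flow: the maximum length of its flow-paths. -/
def leng (F : MFlow G) : ℝ≥0 := F.support.sup SimplePath.length

/-- The maximum step-length of a flow: the maximum number of edges of its flow-paths. -/
def step (F : MFlow G) : ℕ := F.support.sup SimplePath.steps

/-- The path count: the number of flow-paths. -/
def pathCount (F : MFlow G) : ℕ := F.support.card

end MFlow

/-- A demand respects a node-weighting. -/
def Respects {n : ℕ} (D : Fin n → Fin n → ℝ≥0) (A : Fin n → ℝ≥0) : Prop :=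
  ∀ v, ∑ w, D v w ≤ A v ∧ ∑ w, D w v ≤ A v

/-! ### Embeddings and emulators -/

/-- An embedding of `H` into `G`: for every edge `e = {v, w}` of `H`, a `(v, w)`-flow in `G` whose
value is the capacity of `e`. -/
structure Embedding {n : ℕ} (H G : CapGraph n) where
  flow : Fin H.m → MFlow G
  ends : ∀ e, ∀ P ∈ (flow e).support, P.first = H.src e ∧ P.last = H.dst e
  value : ∀ e, (flow e).val = H.cap e

namespace Embedding

variable {n : ℕ} {H G : CapGraph n}

/-- The embedding as one multicommodity flow in `G`. -/
def total (E : Embedding H G) : MFlow G := ∑ e, E.flow e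

/-- Length slack `s`. -/
def HasLengthSlack (E : Embedding H G) (s : ℝ≥0) : Prop :=
  ∀ e, (E.flow e).leng ≤ s * H.len e

end Embedding

/-- `G'` is an `h`-length-constrained `t`-step emulator of the node-weighting `A` in `G` with
length slack `s` and congestion slack `κ`. -/
structure IsEmulatorFor {n : ℕ} (G : CapGraph n) (A : Fin n → ℝ≥0) (G' : CapGraph n) (h t : ℕ)
    (s κ : ℝ≥0) : Prop where
  uniform : ∀ e, G'.len e = s * h
  forward : ∀ F : MFlow G, Respects F.demand A → F.leng ≤ h →
    ∃ F' : MFlow G', F'.demand = F.demand ∧ F'.congestion ≤ κ * F.congestion ∧ F'.step ≤ t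
  backward : ∃ E : Embedding G' G, E.total.congestion ≤ 1 ∧ E.HasLengthSlack 1

/-- `G'` is an `h`-length-constrained `t`-step emulator of `G` (no restriction on the demands that
are routed, i.e. for every node-weighting). -/
def IsEmulator {n : ℕ} (G G' : CapGraph n) (h t : ℕ) (s κ : ℝ≥0) : Prop :=
  ∀ A : Fin n → ℝ≥0, IsEmulatorFor G A G' h t s κ

/-- The predecessor in a sequence of graphs, where the predecessor of the graph with index `0` has
no edges. -/
def prev {n : ℕ} (G' : ℕ → CapGraph n) : ℕ → CapGraph n
  | 0 => CapGraph.empty n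
  | i + 1 => G' i

/-! ### A vector random access machine with work and depth

The memory has scalar registers and a vector memory whose cells hold whole arrays. Every operand
that is a vector is addressed indirectly, through the scalar register that holds its address.
A scalar instruction has work and depth `1`. A vector instruction has work linear in the total
size of its operands and its result; its depth is `1` for instructions without data dependencies
between the entries, and logarithmic for prefix sums and packing. -/

/-- A memory state. -/
structure State where
  reg : ℕ → ℝ≥0
  vec : ℕ → List ℝ≥0

inductive UnOp
  | floor
  | ceil

/-- Unary arithmetic. -/
def UnOp.eval : UnOp → ℝ≥0 → ℝ≥0
  | .floor, x => (⌊x⌋₊ : ℝ≥0)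
  | .ceil, x => (⌈x⌉₊ : ℝ≥0)

inductive BinOp
  | add
  | sub
  | mul
  | div
  | le
  | eq

open Classical in
/-- Binary arithmetic (subtraction is truncated at `0`, and division by `0` gives `0`) and
comparisons with result `1` or `0`. -/
def BinOp.eval : BinOp → ℝ≥0 → ℝ≥0 → ℝ≥0
  | .add, x, y => x + y
  | .sub, x, y => x - y
  | .mul, x, y => x * y
  | .div, x, y => x / y
  | .le, x, y => if x ≤ y then 1 else 0
  | .eq, x, y => if x = y then 1 else 0

namespace State

/-- The natural number in a register. -/
def nat (σ : State) (r : ℕ) : ℕ := ⌊σ.reg r⌋₊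

/-- The vector whose address is in the register `r`. -/
def vecAt (σ : State) (r : ℕ) : List ℝ≥0 := σ.vec (σ.nat r)

def setReg (σ : State) (r : ℕ) (x : ℝ≥0) : State :=
  { σ with reg := Function.update σ.reg r x }

def setVec (σ : State) (a : ℕ) (l : List ℝ≥0) : State :=
  { σ with vec := Function.update σ.vec a l }

/-- The four vectors at the addresses `a, …, a + 3` are the edge list of `G`: first ends, second
ends, capacities, lengths. -/
def Holds {n : ℕ} (σ : State) (a : ℕ) (G : CapGraph n) : Prop :=
  σ.vec a = List.ofFn (fun e => (((G.src e : Fin n) : ℕ) : ℝ≥0)) ∧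
  σ.vec (a + 1) = List.ofFn (fun e => (((G.dst e : Fin n) : ℕ) : ℝ≥0)) ∧
  σ.vec (a + 2) = List.ofFn G.cap ∧
  σ.vec (a + 3) = List.ofFn G.len

/-- The vectors at the addresses `a, …, a + 3` represent the graph `G`, all of whose edges have the
same length: first ends, second ends, capacities, and the common length (one number). -/
def HoldsUniform {n : ℕ} (σ : State) (a : ℕ) (G : CapGraph n) : Prop :=
  σ.vec a = List.ofFn (fun e => (((G.src e : Fin n) : ℕ) : ℝ≥0)) ∧
  σ.vec (a + 1) = List.ofFn (fun e => (((G.dst e : Fin n) : ℕ) : ℝ≥0)) ∧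
  σ.vec (a + 2) = List.ofFn G.cap ∧
  ∃ x : ℝ≥0, σ.vec (a + 3) = [x] ∧ ∀ e, G.len e = x

/-- Write the edge list of `G` to the addresses `a, …, a + 3`. -/
def storeGraph {n : ℕ} (σ : State) (a : ℕ) (G : CapGraph n) : State :=
  (((σ.setVec a (List.ofFn fun e => (((G.src e : Fin n) : ℕ) : ℝ≥0))).setVec
    (a + 1) (List.ofFn fun e => (((G.dst e : Fin n) : ℕ) : ℝ≥0))).setVec
    (a + 2) (List.ofFn G.cap)).setVec (a + 3) (List.ofFn G.len)

end State

/-- Instructions. The letters `r, x, y, k` are scalar registers; `a, b, c` are scalar registers that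
hold addresses of vectors. -/
inductive Instr
  /-- `r := k` for a numeral `k` -/
  | const (r k : ℕ)
  /-- `r := op x` -/
  | un (op : UnOp) (r x : ℕ)
  /-- `r := op x y` -/
  | bin (op : BinOp) (r x y : ℕ)
  /-- `r :=` the length of the vector `b` -/
  | vlen (r b : ℕ)
  /-- `r :=` the entry of the vector `b` with the index in `k` -/
  | vget (r b k : ℕ)
  /-- `a :=` the vector with as many entries as `k` says, all equal to `x` -/
  | vfill (a x k : ℕ)
  /-- `a :=` the vector `0, 1, …` with as many entries as `k` says -/
  | viota (a k : ℕ)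
  /-- entrywise unary operation -/
  | vun (op : UnOp) (a b : ℕ)
  /-- entrywise binary operation -/
  | vbin (op : BinOp) (a b c : ℕ)
  /-- `a :=` the entries of `b` at the indices listed in `c` -/
  | vgather (a b c : ℕ)
  /-- `a :=` the concatenation of `b` and `c` -/
  | vappend (a b c : ℕ)
  /-- `a :=` the prefix sums of `b` -/
  | vscan (a b : ℕ)
  /-- `a :=` the entries of `b` whose flag in `c` is nonzero -/
  | vpack (a b c : ℕ)

namespace Instr

/-- The effect of an instruction. -/
def run (σ : State) : Instr → State
  | const r k => σ.setReg r k
  | un op r x => σ.setReg r (op.eval (σ.reg x))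
  | bin op r x y => σ.setReg r (op.eval (σ.reg x) (σ.reg y))
  | vlen r b => σ.setReg r (σ.vecAt b).length
  | vget r b k => σ.setReg r ((σ.vecAt b).getD (σ.nat k) 0)
  | vfill a x k => σ.setVec (σ.nat a) (List.replicate (σ.nat k) (σ.reg x))
  | viota a k => σ.setVec (σ.nat a) ((List.range (σ.nat k)).map fun j => (j : ℝ≥0))
  | vun op a b => σ.setVec (σ.nat a) ((σ.vecAt b).map op.eval)
  | vbin op a b c => σ.setVec (σ.nat a) (List.zipWith op.eval (σ.vecAt b) (σ.vecAt c))
  | vgather a b c => σ.setVec (σ.nat a) ((σ.vecAt c).map fun x => (σ.vecAt b).getD ⌊x⌋₊ 0)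
  | vappend a b c => σ.setVec (σ.nat a) (σ.vecAt b ++ σ.vecAt c)
  | vscan a b => σ.setVec (σ.nat a) ((σ.vecAt b).scanl (· + ·) 0).tail
  | vpack a b c => σ.setVec (σ.nat a)
      ((((σ.vecAt b).zip (σ.vecAt c)).filter fun p => decide (p.2 ≠ 0)).map Prod.fst)

/-- The work of an instruction. -/
def work (σ : State) : Instr → ℕ
  | const _ _ | un _ _ _ | bin _ _ _ _ | vlen _ _ | vget _ _ _ => 1
  | vfill _ _ k | viota _ k => 1 + σ.nat k
  | vun _ _ b | vscan _ b => 1 + (σ.vecAt b).length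
  | vbin _ _ b c | vgather _ b c | vappend _ b c | vpack _ b c =>
      1 + (σ.vecAt b).length + (σ.vecAt c).length

/-- The depth of an instruction. -/
def depth (σ : State) : Instr → ℕ
  | vscan _ b => 1 + Nat.clog 2 (σ.vecAt b).length
  | vpack _ b c => 1 + Nat.clog 2 ((σ.vecAt b).length + (σ.vecAt c).length)
  | _ => 1

end Instr

/-- Programs over the instructions, with calls to an external algorithm that maps a graph and a
number to a graph. -/
inductive Prog
  | instr (c : Instr)
  | seq (p q : Prog)
  /-- repeat `p` as long as the register `r` is nonzero -/
  | loop (r : ℕ) (p : Prog)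
  /-- call the external algorithm on the graph stored from the address in `a` on and the number in
  `k`; it writes its result from the address in `b` on -/
  | call (a k b : ℕ)

/-- `Exec O p σ τ w δ l`: the program `p` with the external algorithm `O`, started in the state `σ`,
halts in the state `τ`; outside the calls it has work `w` and depth `δ`, and `l` lists the inputs
of its calls. -/
inductive Exec {n : ℕ} (O : CapGraph n → ℕ → CapGraph n) :
    Prog → State → State → ℕ → ℕ → List (CapGraph n × ℕ) → Prop
  | instr (c : Instr) (σ : State) :
      Exec O (.instr c) σ (c.run σ) (c.work σ) (c.depth σ) []
  | seq {p q : Prog} {σ τ υ : State} {w w' δ δ' : ℕ} {l l' : List (CapGraph n × ℕ)} :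
      Exec O p σ τ w δ l → Exec O q τ υ w' δ' l' →
      Exec O (.seq p q) σ υ (w + w') (δ + δ') (l ++ l')
  | loop_done {r : ℕ} {p : Prog} {σ : State} :
      σ.reg r = 0 → Exec O (.loop r p) σ σ 1 1 []
  | loop_step {r : ℕ} {p : Prog} {σ τ υ : State} {w w' δ δ' : ℕ}
      {l l' : List (CapGraph n × ℕ)} :
      σ.reg r ≠ 0 → Exec O p σ τ w δ l → Exec O (.loop r p) τ υ w' δ' l' →
      Exec O (.loop r p) σ υ (1 + w + w') (1 + δ + δ') (l ++ l')
  | call {a k b : ℕ} {σ : State} {H : CapGraph n} :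
      σ.Holds (σ.nat a) H →
      Exec O (.call a k b) σ (σ.storeGraph (σ.nat b) (O H (σ.nat k))) 1 1 [(H, σ.nat k)]

/-- The initial state: the parameters `h, d, t, h₀`, the length slack `s` and the number of vertices
are in the first registers, the edge list of `G` is in the first four vectors, and the rest of the
memory is empty. -/
def inputState {n : ℕ} (G : CapGraph n) (h d t h₀ : ℕ) (s : ℝ≥0) : State :=
  State.storeGraph
    { reg := fun r => ([(h : ℝ≥0), (d : ℝ≥0), (t : ℝ≥0), (h₀ : ℝ≥0), s, (n : ℝ≥0)]).getD r 0
      vec := fun _ => [] } 0 G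

end LowStep

end

/-!
The emulators are built in stages. Stage `i` forms a graph on which the given algorithm is called
(`stage`, `emuInput`): it consists of the edges of `G` with length in `(h₀ h^(i-1), h₀ h^i]` and of
the edges of the previous emulator. Lengths are measured in units of `h₀ h^(i-1)` and rounded up for
edges of `G`, and set to `1` for edges of the previous emulator; capacities are halved. Stage `0`
takes the edges of length at most `h₀`, in unit `1`. The result of the call, with its edge lengths
converted back, is the next emulator (`emuSeq`).

*Routing demands in the emulator.* A flow-path of length at most `h₀ h^i` is cut greedily into edges
longer than `h₀ h^(i-1)` and at most `2h` short segments (`exists_segments`). The short segments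
form a flow of length at most `h₀ h^(i-1)`, which the previous emulator routes in `t` steps; the
flow it finds for a pair of ends is split among the segments with these ends in proportion to their
values. Concatenation gives a flow in the stage (`exists_stage_flow`) of length at most
`2ht + 2h ≤ (2t+3)h`, since rounding at most doubles the length of a long edge
(`exists_emuInput_flow`), so the algorithm applies to it. Halving the capacities costs the
factor `2` in the congestion slack.

*Embedding the emulator.* The embedding into the stage is an embedding into the union of `G` and the
previous emulator of congestion at most `1/2` (`exists_stage_embedding`), which can be composed with
the embedding of the previous emulator into `G` (`Embedding.exists_comp`). That the converted
lengths are not shorter than the original ones needs `s ≥ 1`, and that the long edges are not the bottleneck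
needs `2κ ≥ 1`. On at least two vertices both follow from emulating a single edge (`one_le_slacks`),
and on at most one vertex no simple path has an edge.

Both parts rest on one lemma on rerouting flow-paths piece by piece, `MFlow.exists_reroute`, with
loop erasure keeping all paths simple.

*The program.* A stage is built by flagging the edges of `G` in the range, packing their data and
appending those of the previous emulator, so its work is linear in the number of edges, and only the
packing, on vectors of the size of `G`, has more than constant depth. The invariant `Inv` describes
the memory before each stage.
-/

noncomputable section

namespace LowStep

/-! ### Walks and simple paths -/

section Paths

variable {n : ℕ} {G H : CapGraph n}

namespace CapGraph

lemma IsWalk.append {l₁ l₂ : List (Fin G.m × Bool)} :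
    ∀ {u v w : Fin n}, G.IsWalk u v l₁ → G.IsWalk v w l₂ → G.IsWalk u w (l₁ ++ l₂) := by
  induction l₁ with
  | nil => rintro u v w rfl h; exact h
  | cons a l ih => rintro u v w ⟨h₁, h₂⟩ h; exact ⟨h₁, ih h₂ h⟩

/-- The traversed edge in the opposite direction. -/
def flip (a : Fin G.m × Bool) : Fin G.m × Bool := (a.1, !a.2)

lemma tail_flip (a : Fin G.m × Bool) : G.tail (flip a) = G.head a := by
  rcases a with ⟨e, _ | _⟩ <;> rfl

lemma head_flip (a : Fin G.m × Bool) : G.head (flip a) = G.tail a := by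
  rcases a with ⟨e, _ | _⟩ <;> rfl

lemma IsWalk.reverse {l : List (Fin G.m × Bool)} :
    ∀ {v w : Fin n}, G.IsWalk v w l → G.IsWalk w v (l.map flip).reverse := by
  induction l with
  | nil => rintro v w rfl; rfl
  | cons a l ih =>
    rintro v w ⟨rfl, h⟩
    simp only [List.map_cons, List.reverse_cons]
    exact (ih h).append ⟨tail_flip a, head_flip a⟩

end CapGraph

namespace SimplePath

/-- The path without edges at a vertex. -/
def trivial (G : CapGraph n) (v : Fin n) : SimplePath G := ⟨v, v, [], rfl, by simp⟩

/-- The indicator of the edges of a path. -/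
def ind (P : SimplePath G) (e : Fin G.m) : ℝ≥0 :=
  if e ∈ P.darts.map Prod.fst then 1 else 0

/-- A simple path has a simple path to its last vertex from each of its vertices. -/
lemma exists_suffix {l : List (Fin G.m × Bool)} : ∀ {v w : Fin n} (u : Fin n), G.IsWalk v w l →
    (v :: l.map G.head).Nodup → u ∈ v :: l.map G.head →
    ∃ P : SimplePath G, P.first = u ∧ P.last = w ∧ P.darts.Sublist l := by
  induction l with
  | nil =>
    rintro v w u rfl - hu
    obtain rfl : u = v := by simpa using hu
    exact ⟨trivial G u, rfl, rfl, List.Sublist.refl _⟩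
  | cons a l ih =>
    rintro v w u h hn hu
    rw [List.mem_cons] at hu
    rcases hu with rfl | hu
    · exact ⟨⟨u, w, a :: l, h, hn⟩, rfl, rfl, List.Sublist.refl _⟩
    · obtain ⟨P, h₁, h₂, h₃⟩ := ih u h.2 (List.nodup_cons.1 hn).2 hu
      exact ⟨P, h₁, h₂, h₃.cons a⟩

/-- Loop erasure: a walk contains a simple path with the same ends. -/
lemma exists_of_isWalk {l : List (Fin G.m × Bool)} : ∀ {v w : Fin n}, G.IsWalk v w l →
    ∃ P : SimplePath G, P.first = v ∧ P.last = w ∧ P.darts.Sublist l := by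
  induction l with
  | nil => rintro v w rfl; exact ⟨trivial G v, rfl, rfl, List.Sublist.refl _⟩
  | cons a l ih =>
    rintro v w ⟨h₁, h₂⟩
    obtain ⟨P, hf, hl, hs⟩ := ih h₂
    by_cases hv : v ∈ P.first :: P.darts.map G.head
    · obtain ⟨Q, h₃, h₄, h₅⟩ := exists_suffix v P.isWalk P.nodup hv
      exact ⟨Q, h₃, h₄.trans hl, (h₅.trans hs).cons a⟩
    · refine ⟨⟨v, w, a :: P.darts, ⟨h₁, ?_⟩, ?_⟩, rfl, rfl, hs.cons_cons a⟩
      · rw [← hf, ← hl]; exact P.isWalk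
      · rw [hf] at hv
        have := P.nodup
        rw [hf] at this
        exact List.nodup_cons.2 ⟨hv, this⟩

lemma exists_append (P Q : SimplePath G) (h : P.last = Q.first) :
    ∃ R : SimplePath G, R.first = P.first ∧ R.last = Q.last ∧
      R.darts.Sublist (P.darts ++ Q.darts) :=
  exists_of_isWalk (P.isWalk.append (h ▸ Q.isWalk))

lemma exists_reverse (P : SimplePath G) :
    ∃ R : SimplePath G, R.first = P.last ∧ R.last = P.first ∧
      R.darts.Sublist (P.darts.map CapGraph.flip).reverse :=
  exists_of_isWalk P.isWalk.reverse

lemma exists_dart (a : Fin G.m × Bool) :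
    ∃ R : SimplePath G, R.first = G.tail a ∧ R.last = G.head a ∧ R.darts.Sublist [a] :=
  exists_of_isWalk ⟨rfl, rfl⟩

lemma nodup_edges_aux {l : List (Fin G.m × Bool)} : ∀ {v w : Fin n}, G.IsWalk v w l →
    (v :: l.map G.head).Nodup → (l.map Prod.fst).Nodup := by
  induction l with
  | nil => intros; simp
  | cons a l ih =>
    rintro v w ⟨h₁, h₂⟩ hn
    rw [List.map_cons, List.nodup_cons]
    obtain ⟨hn₁, hn₂⟩ := List.nodup_cons.1 hn
    -- using the edge again means to repeat its head or to return to its tail, the first vertex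
    refine ⟨fun ha => ?_, ih h₂ hn₂⟩
    obtain ⟨b, hb, hba⟩ := List.mem_map.1 ha
    have hb' : G.head b ∈ l.map G.head := List.mem_map_of_mem hb
    obtain rfl | rfl : b = a ∨ b = CapGraph.flip a := by
      rcases a with ⟨e, _ | _⟩ <;> rcases b with ⟨f, _ | _⟩ <;>
        simp_all [CapGraph.flip]
    · exact (List.nodup_cons.1 hn₂).1 hb'
    · rw [CapGraph.head_flip, h₁] at hb'
      exact hn₁ (List.mem_cons_of_mem _ hb')

/-- A simple path uses no edge twice. -/
lemma nodup_edges (P : SimplePath G) : (P.darts.map Prod.fst).Nodup :=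
  nodup_edges_aux P.isWalk P.nodup

lemma ind_le_one (P : SimplePath G) (e : Fin G.m) : P.ind e ≤ 1 := by
  unfold ind; split_ifs <;> simp

lemma ind_le_of_subset {P : SimplePath G} {s : List (Fin G.m)}
    (h : ∀ e ∈ P.darts.map Prod.fst, e ∈ s) (e : Fin G.m) : P.ind e ≤ if e ∈ s then 1 else 0 := by
  unfold ind
  by_cases h₁ : e ∈ P.darts.map Prod.fst
  · rw [if_pos h₁, if_pos (h e h₁)]
  · rw [if_neg h₁]; exact zero_le

lemma length_le_of_sublist {P : SimplePath G} {l : List (Fin G.m × Bool)}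
    (h : P.darts.Sublist l) : P.length ≤ (l.map fun a => G.len a.1).sum :=
  (h.map _).sum_le_sum fun _ _ => zero_le

/-- Sums over the edges of a simple path. -/
lemma sum_darts (P : SimplePath G) (f : Fin G.m → ℝ≥0) :
    (P.darts.map fun a => f a.1).sum = ∑ e, P.ind e * f e := by
  have h := List.sum_toFinset f P.nodup_edges
  rw [List.map_map] at h
  refine h.symm.trans ?_
  simp only [ind, ite_mul, one_mul, zero_mul]
  rw [← Finset.sum_filter]
  congr 1
  ext e
  simp

/-- On at most one vertex, simple paths have no edges. -/
lemma darts_eq_nil (hn : n ≤ 1) (P : SimplePath G) : P.darts = [] := by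
  have h := P.nodup.length_le_card
  simp only [List.length_cons, List.length_map, Fintype.card_fin] at h
  exact List.length_eq_zero_iff.1 (by omega)

/-- A map of edges that keeps the ends, applied to a path. -/
def map (φ : Fin G.m → Fin H.m) (hs : ∀ e, H.src (φ e) = G.src e)
    (hd : ∀ e, H.dst (φ e) = G.dst e) (P : SimplePath G) : SimplePath H where
  first := P.first
  last := P.last
  darts := P.darts.map fun a => (φ a.1, a.2)
  isWalk := by
    have : ∀ (l : List (Fin G.m × Bool)) (v w : Fin n), G.IsWalk v w l →
        H.IsWalk v w (l.map fun a => (φ a.1, a.2)) := by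
      intro l
      induction l with
      | nil => intro v w h; exact h
      | cons a l ih =>
        intro v w h
        refine ⟨?_, ih _ _ ?_⟩
        · simpa [CapGraph.tail, hs, hd] using h.1
        · simpa [CapGraph.head, hs, hd] using h.2
    exact this _ _ _ P.isWalk
  nodup := by
    have : H.head ∘ (fun a : Fin G.m × Bool => (φ a.1, a.2)) = G.head := by
      funext a; simp [CapGraph.head, hs, hd]
    rw [List.map_map, this]; exact P.nodup

lemma ind_map {φ : Fin G.m → Fin H.m} (hφ : Function.Injective φ) (hs hd) (P : SimplePath G)
    (e : Fin G.m) : (P.map (H := H) φ hs hd).ind (φ e) = P.ind e := by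
  have : φ e ∈ (P.map (H := H) φ hs hd).darts.map Prod.fst ↔ e ∈ P.darts.map Prod.fst := by
    simp [map, hφ.eq_iff]
  simp only [ind, this]

lemma ind_map_eq_zero {φ : Fin G.m → Fin H.m} (hs hd) (P : SimplePath G)
    (e : Fin H.m) (he : ∀ x, φ x ≠ e) : (P.map (H := H) φ hs hd).ind e = 0 := by
  rw [ind, if_neg]
  simp [map, he]

end SimplePath

end Paths

/-! ### Flows as linear combinations of paths -/

section Flows

variable {n : ℕ} {G H : CapGraph n}

namespace MFlow

/-- The linear extension to flows of a weight of paths. Value, flow through an edge and demand are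
of this form. -/
def weigh (c : SimplePath G → ℝ≥0) : MFlow G →ₗ[ℝ≥0] ℝ≥0 := Finsupp.linearCombination ℝ≥0 c

lemma weigh_apply (c : SimplePath G → ℝ≥0) (F : MFlow G) :
    weigh c F = ∑ P ∈ F.support, F P * c P := by
  simp [weigh, Finsupp.linearCombination_apply, Finsupp.sum]

@[simp] lemma weigh_single (c : SimplePath G → ℝ≥0) (P : SimplePath G) (x : ℝ≥0) :
    weigh c (Finsupp.single P x) = x * c P := by
  simp [weigh]

lemma weigh_mapDomain (c : SimplePath H → ℝ≥0) (f : SimplePath G → SimplePath H) (F : MFlow G) :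
    weigh c (Finsupp.mapDomain f F : MFlow H) = weigh (fun P => c (f P)) F := by
  simp only [weigh, Finsupp.linearCombination_mapDomain]; rfl

lemma weigh_mono {c c' : SimplePath G → ℝ≥0} {F : MFlow G} (h : ∀ P ∈ F.support, c P ≤ c' P) :
    weigh c F ≤ weigh c' F := by
  rw [weigh_apply, weigh_apply]
  exact Finset.sum_le_sum fun P hP => mul_le_mul_right (h P hP) _

lemma weigh_congr {c c' : SimplePath G → ℝ≥0} {F : MFlow G} (h : ∀ P ∈ F.support, c P = c' P) :
    weigh c F = weigh c' F := by
  rw [weigh_apply, weigh_apply]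
  exact Finset.sum_congr rfl fun P hP => by rw [h P hP]

lemma weigh_const_mul (c : SimplePath G → ℝ≥0) (F : MFlow G) (x : ℝ≥0) :
    weigh (fun P => c P * x) F = weigh c F * x := by
  rw [weigh_apply, weigh_apply, Finset.sum_mul]
  exact Finset.sum_congr rfl fun P _ => (mul_assoc _ _ _).symm

lemma weigh_sum {ι : Type*} (s : Finset ι) (c : ι → SimplePath G → ℝ≥0) (F : MFlow G) :
    weigh (fun P => ∑ i ∈ s, c i P) F = ∑ i ∈ s, weigh (c i) F := by
  simp only [weigh_apply, Finset.mul_sum]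
  exact Finset.sum_comm

lemma val_eq (F : MFlow G) : F.val = weigh (fun _ => 1) F := by
  simp [weigh_apply, val]

lemma onEdge_eq (F : MFlow G) (e : Fin G.m) : F.onEdge e = weigh (fun P => P.ind e) F := by
  rw [onEdge, Finset.sum_filter, weigh_apply]
  refine Finset.sum_congr rfl fun P _ => ?_
  by_cases h : P.Uses e
  · rw [SimplePath.ind, if_pos h, if_pos (show e ∈ P.darts.map Prod.fst from h), mul_one]
  · rw [SimplePath.ind, if_neg h, if_neg (show e ∉ P.darts.map Prod.fst from h), mul_zero]

lemma demand_eq (F : MFlow G) (v w : Fin n) :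
    F.demand v w = weigh (fun P => if P.first = v ∧ P.last = w then 1 else 0) F := by
  simp [weigh_apply, demand, Finset.sum_filter]

/-- A weight that depends only on the ends of a path only sees the demand. -/
lemma weigh_ends (c : Fin n → Fin n → ℝ≥0) (F : MFlow G) :
    weigh (fun P => c P.first P.last) F = ∑ v, ∑ w, F.demand v w * c v w := by
  simp only [demand_eq, ← weigh_const_mul, ← weigh_sum]
  congr 2
  funext P
  simp only [ite_mul, one_mul, zero_mul, ite_and]
  simp

lemma onEdge_le (F : MFlow G) (e : Fin G.m) : F.onEdge e ≤ F.congestion * G.cap e := by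
  rw [← div_le_iff₀ (G.cap_pos e)]
  exact Finset.le_sup (f := fun e => F.onEdge e / G.cap e) (Finset.mem_univ e)

lemma congestion_le_iff {F : MFlow G} {x : ℝ≥0} :
    F.congestion ≤ x ↔ ∀ e, F.onEdge e ≤ x * G.cap e := by
  simp only [congestion, Finset.sup_le_iff, Finset.mem_univ, true_imp_iff]
  exact forall_congr' fun e => div_le_iff₀ (G.cap_pos e)

lemma leng_le_iff {F : MFlow G} {x : ℝ≥0} : F.leng ≤ x ↔ ∀ P ∈ F.support, P.length ≤ x := by
  simp [leng, Finset.sup_le_iff]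

lemma step_le_iff {F : MFlow G} {x : ℕ} : F.step ≤ x ↔ ∀ P ∈ F.support, P.steps ≤ x := by
  simp [step, Finset.sup_le_iff]

/-- A unit flow from `v` to `w`. -/
def IsUnit (f : MFlow G) (v w : Fin n) : Prop :=
  (∀ P ∈ f.support, P.first = v ∧ P.last = w) ∧ f.val = 1

lemma isUnit_single (P : SimplePath G) : IsUnit (Finsupp.single P 1) P.first P.last := by
  refine ⟨fun Q hQ => ?_, ?_⟩
  · obtain rfl : Q = P := by simpa using Finsupp.support_single_subset hQ
    exact ⟨rfl, rfl⟩
  · simp [val_eq]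

/-- Unit flows are concatenated by taking all concatenations of their paths, weighted by the
product of the values. -/
lemma exists_concat {f g : MFlow G} {u v w : Fin n} (hf : f.IsUnit u v) (hg : g.IsUnit v w) :
    ∃ k : MFlow G, k.IsUnit u w ∧ (∀ e, k.onEdge e ≤ f.onEdge e + g.onEdge e) ∧
      k.leng ≤ f.leng + g.leng := by
  classical
  have hJ : ∀ P Q : SimplePath G, ∃ R : SimplePath G, P.last = Q.first →
      R.first = P.first ∧ R.last = Q.last ∧ R.darts.Sublist (P.darts ++ Q.darts) := by
    intro P Q
    by_cases h : P.last = Q.first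
    · obtain ⟨R, hR⟩ := SimplePath.exists_append P Q h
      exact ⟨R, fun _ => hR⟩
    · exact ⟨P, fun h' => absurd h' h⟩
  choose J hJ using hJ
  have hJ' : ∀ P ∈ f.support, ∀ Q ∈ g.support, (J P Q).first = u ∧ (J P Q).last = w ∧
      (J P Q).darts.Sublist (P.darts ++ Q.darts) := by
    intro P hP Q hQ
    have h := hJ P Q ((hf.1 P hP).2.trans (hg.1 Q hQ).1.symm)
    exact ⟨h.1.trans (hf.1 P hP).1, h.2.1.trans (hg.1 Q hQ).2, h.2.2⟩
  set k : MFlow G := ∑ P ∈ f.support, ∑ Q ∈ g.support, Finsupp.single (J P Q) (f P * g Q) with hk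
  have hsupp : ∀ R ∈ k.support, ∃ P ∈ f.support, ∃ Q ∈ g.support, R = J P Q := by
    intro R hR
    obtain ⟨P, hP, hR⟩ := Finset.mem_biUnion.1 (Finsupp.support_finsetSum hR)
    obtain ⟨Q, hQ, hR⟩ := Finset.mem_biUnion.1 (Finsupp.support_finsetSum hR)
    exact ⟨P, hP, Q, hQ, by simpa using Finsupp.support_single_subset hR⟩
  have hw : ∀ c : SimplePath G → ℝ≥0,
      weigh c k = ∑ P ∈ f.support, ∑ Q ∈ g.support, f P * g Q * c (J P Q) := by
    intro c; simp only [hk, map_sum, weigh_single]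
  have hfv := hf.2
  have hgv := hg.2
  rw [val] at hfv hgv
  refine ⟨k, ⟨fun R hR => ?_, ?_⟩, fun e => ?_, leng_le_iff.2 fun R hR => ?_⟩
  · obtain ⟨P, hP, Q, hQ, rfl⟩ := hsupp R hR
    exact ⟨(hJ' P hP Q hQ).1, (hJ' P hP Q hQ).2.1⟩
  · rw [val_eq, hw]
    simp only [mul_one, ← Finset.mul_sum, hgv, hfv]
  · rw [onEdge_eq, hw]
    calc ∑ P ∈ f.support, ∑ Q ∈ g.support, f P * g Q * (J P Q).ind e
        ≤ ∑ P ∈ f.support, ∑ Q ∈ g.support, (f P * P.ind e * g Q + f P * (g Q * Q.ind e)) := by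
          refine Finset.sum_le_sum fun P hP => Finset.sum_le_sum fun Q hQ => ?_
          have : (J P Q).ind e ≤ P.ind e + Q.ind e := by
            have hs := ((hJ' P hP Q hQ).2.2.map Prod.fst).subset
            refine (SimplePath.ind_le_of_subset (fun e he => hs he) e).trans ?_
            unfold SimplePath.ind
            simp only [List.map_append, List.mem_append]
            split_ifs <;> simp_all
          calc f P * g Q * (J P Q).ind e ≤ f P * g Q * (P.ind e + Q.ind e) := by gcongr
            _ = _ := by ring
      _ = f.onEdge e + g.onEdge e := by
          simp only [Finset.sum_add_distrib, ← Finset.mul_sum, hgv, mul_one, onEdge_eq, weigh_apply]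
          rw [← Finset.sum_mul, hfv, one_mul]
  · obtain ⟨P, hP, Q, hQ, rfl⟩ := hsupp R hR
    refine (SimplePath.length_le_of_sublist (hJ' P hP Q hQ).2.2).trans ?_
    rw [List.map_append, List.sum_append]
    exact add_le_add (leng_le_iff.1 le_rfl P hP) (leng_le_iff.1 le_rfl Q hQ)

end MFlow

/-- The items of the list, each with a start and an end, lead from `v` to `w`. -/
def IsChain {ι V : Type*} (st en : ι → V) : V → V → List ι → Prop
  | v, w, [] => v = w
  | v, w, x :: l => st x = v ∧ IsChain st en (en x) w l

lemma CapGraph.IsWalk.isChain {l : List (Fin G.m × Bool)} :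
    ∀ {v w : Fin n}, G.IsWalk v w l → IsChain G.tail G.head v w l := by
  induction l with
  | nil => intro v w h; exact h
  | cons a l ih => intro v w h; exact ⟨h.1, ih h.2⟩

namespace MFlow

lemma exists_concat_list {ι : Type*} {st en : ι → Fin n} (g : ι → MFlow G) (l : List ι) :
    ∀ {v w : Fin n}, IsChain st en v w l → (∀ x ∈ l, (g x).IsUnit (st x) (en x)) →
    ∃ k : MFlow G, k.IsUnit v w ∧ (∀ e, k.onEdge e ≤ (l.map fun x => (g x).onEdge e).sum) ∧
      k.leng ≤ (l.map fun x => (g x).leng).sum := by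
  induction l with
  | nil =>
    rintro v w rfl -
    refine ⟨_, isUnit_single (SimplePath.trivial G v), fun e => ?_, leng_le_iff.2 fun P hP => ?_⟩
    · simp [onEdge_eq, SimplePath.ind, SimplePath.trivial]
    · obtain rfl : P = _ := by simpa using Finsupp.support_single_subset hP
      simp [SimplePath.length, SimplePath.trivial]
  | cons x l ih =>
    rintro v w ⟨rfl, h⟩ hg
    obtain ⟨k, h₁, h₂, h₃⟩ := ih h fun y hy => hg y (List.mem_cons_of_mem _ hy)
    obtain ⟨k', h₁', h₂', h₃'⟩ := exists_concat (hg x List.mem_cons_self) h₁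
    refine ⟨k', h₁', fun e => (h₂' e).trans ?_, h₃'.trans ?_⟩
    · rw [List.map_cons, List.sum_cons]; gcongr; exact h₂ e
    · rw [List.map_cons, List.sum_cons]; gcongr

/-- Rerouting: if every flow-path of `F` is cut into items and there is a unit flow in `G` for every
item, then the demand of `F` can be routed in `G` by concatenating these unit flows. -/
lemma exists_reroute {ι : Type*} {st en : ι → Fin n} (F : MFlow H) (items : SimplePath H → List ι)
    (hchain : ∀ P ∈ F.support, IsChain st en P.first P.last (items P)) (g : ι → MFlow G)
    (hg : ∀ P ∈ F.support, ∀ x ∈ items P, (g x).IsUnit (st x) (en x)) :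
    ∃ F' : MFlow G, F'.demand = F.demand ∧ F'.val = F.val ∧
      (∀ Q ∈ F'.support, ∃ P ∈ F.support, Q.first = P.first ∧ Q.last = P.last ∧
        Q.length ≤ ((items P).map fun x => (g x).leng).sum) ∧
      ∀ e, F'.onEdge e ≤ weigh (fun P => ((items P).map fun x => (g x).onEdge e).sum) F := by
  classical
  have : ∀ P : SimplePath H, ∃ k : MFlow G, P ∈ F.support → k.IsUnit P.first P.last ∧
      (∀ e, k.onEdge e ≤ ((items P).map fun x => (g x).onEdge e).sum) ∧
      k.leng ≤ ((items P).map fun x => (g x).leng).sum := by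
    intro P
    by_cases hP : P ∈ F.support
    · obtain ⟨k, hk⟩ := exists_concat_list g (items P) (hchain P hP) (hg P hP)
      exact ⟨k, fun _ => hk⟩
    · exact ⟨0, fun h => absurd h hP⟩
  choose k hk using this
  set F' : MFlow G := ∑ P ∈ F.support, F P • k P with hF'
  have hw : ∀ c : SimplePath G → ℝ≥0, weigh c F' = ∑ P ∈ F.support, F P * weigh c (k P) := by
    intro c; simp [hF']
  have hval : ∀ P ∈ F.support, weigh (fun _ => 1) (k P) = 1 := fun P hP => by
    rw [← val_eq]; exact (hk P hP).1.2
  refine ⟨F', ?_, ?_, fun Q hQ => ?_, fun e => ?_⟩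
  · funext v w
    rw [demand_eq, demand_eq, hw, weigh_apply]
    refine Finset.sum_congr rfl fun P hP => ?_
    congr 1
    rw [← one_mul (ite _ _ _), ← hval P hP, ← weigh_const_mul]
    refine weigh_congr fun Q hQ => ?_
    rw [((hk P hP).1.1 Q hQ).1, ((hk P hP).1.1 Q hQ).2, one_mul]
  · rw [val_eq, val_eq, hw, weigh_apply]
    exact Finset.sum_congr rfl fun P hP => by rw [hval P hP]
  · obtain ⟨P, hP, hQ⟩ := Finset.mem_biUnion.1 (Finsupp.support_finsetSum hQ)
    have hQ := Finsupp.support_smul hQ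
    have h := (hk P hP).1.1 Q hQ
    exact ⟨P, hP, h.1, h.2, (leng_le_iff.1 le_rfl Q hQ).trans (hk P hP).2.2⟩
  · rw [onEdge_eq, hw, weigh_apply]
    refine Finset.sum_le_sum fun P hP => ?_
    rw [← onEdge_eq]
    exact mul_le_mul_right ((hk P hP).2.1 e) _

end MFlow

end Flows

/-! ### Embeddings and their composition -/

section Embeddings

variable {n : ℕ} {G H K : CapGraph n}

namespace CapGraph

@[simp] lemma union_src_left (e : Fin G.m) : (G.union H).src (Fin.castAdd H.m e) = G.src e :=
  Fin.append_left _ _ _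
@[simp] lemma union_src_right (e : Fin H.m) : (G.union H).src (Fin.natAdd G.m e) = H.src e :=
  Fin.append_right _ _ _
@[simp] lemma union_dst_left (e : Fin G.m) : (G.union H).dst (Fin.castAdd H.m e) = G.dst e :=
  Fin.append_left _ _ _
@[simp] lemma union_dst_right (e : Fin H.m) : (G.union H).dst (Fin.natAdd G.m e) = H.dst e :=
  Fin.append_right _ _ _
@[simp] lemma union_cap_left (e : Fin G.m) : (G.union H).cap (Fin.castAdd H.m e) = G.cap e :=
  Fin.append_left _ _ _
@[simp] lemma union_cap_right (e : Fin H.m) : (G.union H).cap (Fin.natAdd G.m e) = H.cap e :=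
  Fin.append_right _ _ _
@[simp] lemma union_len_left (e : Fin G.m) : (G.union H).len (Fin.castAdd H.m e) = G.len e :=
  Fin.append_left _ _ _
@[simp] lemma union_len_right (e : Fin H.m) : (G.union H).len (Fin.natAdd G.m e) = H.len e :=
  Fin.append_right _ _ _

end CapGraph

namespace Embedding

lemma onEdge_total (E : Embedding H G) (x : Fin G.m) :
    E.total.onEdge x = ∑ e, (E.flow e).onEdge x := by
  simp only [MFlow.onEdge_eq, total, map_sum]

lemma exists_flow_of_mem_total {E : Embedding H G} {P : SimplePath G} (hP : P ∈ E.total.support) :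
    ∃ e, P ∈ (E.flow e).support := by
  classical
  obtain ⟨e, -, he⟩ := Finset.mem_biUnion.1 (Finsupp.support_finsetSum hP)
  exact ⟨e, he⟩

/-- The unit flows along which an embedding routes the two directions of an edge. -/
lemma exists_unit_flow (E : Embedding H G) (a : Fin H.m × Bool) :
    ∃ g : MFlow G, g.IsUnit (H.tail a) (H.head a) ∧
      (∀ x, g.onEdge x ≤ (E.flow a.1).onEdge x / H.cap a.1) ∧ g.leng ≤ (E.flow a.1).leng := by
  classical
  obtain ⟨e, b⟩ := a
  have hc : H.cap e ≠ 0 := (H.cap_pos e).ne'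
  have hv : (H.cap e)⁻¹ * MFlow.weigh (fun _ => 1) (E.flow e) = 1 := by
    rw [← MFlow.val_eq, E.value, inv_mul_cancel₀ hc]
  cases b
  · choose R hR using SimplePath.exists_reverse (G := G)
    have hsub : ∀ P, ∀ x ∈ (R P).darts.map Prod.fst, x ∈ P.darts.map Prod.fst := by
      intro P x hx
      have := ((hR P).2.2.map Prod.fst).subset hx
      simpa [CapGraph.flip] using this
    refine ⟨(H.cap e)⁻¹ • (Finsupp.mapDomain R (E.flow e) : MFlow G), ⟨fun Q hQ => ?_, ?_⟩,
      fun x => ?_, MFlow.leng_le_iff.2 fun Q hQ => ?_⟩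
    · obtain ⟨P, hP, rfl⟩ := Finset.mem_image.1
        (Finsupp.mapDomain_support (Finsupp.support_smul hQ))
      rw [(hR P).1, (hR P).2.1, (E.ends e P hP).1, (E.ends e P hP).2]
      exact ⟨rfl, rfl⟩
    · rw [MFlow.val_eq, map_smul, MFlow.weigh_mapDomain, smul_eq_mul, hv]
    · rw [MFlow.onEdge_eq, map_smul, MFlow.weigh_mapDomain, smul_eq_mul, div_eq_inv_mul,
        MFlow.onEdge_eq]
      exact mul_le_mul_right (MFlow.weigh_mono fun P _ =>
        SimplePath.ind_le_of_subset (hsub P) x) _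
    · obtain ⟨P, hP, rfl⟩ := Finset.mem_image.1
        (Finsupp.mapDomain_support (Finsupp.support_smul hQ))
      refine (SimplePath.length_le_of_sublist (hR P).2.2).trans ?_
      refine le_trans (le_of_eq ?_) (MFlow.leng_le_iff.1 le_rfl P hP)
      rw [List.map_reverse, List.sum_reverse, List.map_map]
      rfl
  · refine ⟨(H.cap e)⁻¹ • E.flow e, ⟨fun Q hQ => E.ends e Q (Finsupp.support_smul hQ), ?_⟩,
      fun x => ?_, MFlow.leng_le_iff.2 fun Q hQ =>
        MFlow.leng_le_iff.1 le_rfl Q (Finsupp.support_smul hQ)⟩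
    · rw [MFlow.val_eq, map_smul, smul_eq_mul, hv]
    · rw [MFlow.onEdge_eq, map_smul, smul_eq_mul, div_eq_inv_mul, MFlow.onEdge_eq]

/-- The image of a flow under an embedding. -/
lemma exists_image (E : Embedding H G) (F : MFlow H) :
    ∃ F' : MFlow G, F'.demand = F.demand ∧ F'.val = F.val ∧
      (∀ Q ∈ F'.support, ∃ P ∈ F.support, Q.first = P.first ∧ Q.last = P.last ∧
        Q.length ≤ (P.darts.map fun a => (E.flow a.1).leng).sum) ∧
      ∀ x, F'.onEdge x ≤ F.congestion * E.total.onEdge x ∧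
        F'.onEdge x ≤ ∑ e, F.onEdge e * ((E.flow e).onEdge x / H.cap e) := by
  choose g hg using E.exists_unit_flow
  obtain ⟨F', h₁, h₂, h₃, h₄⟩ := F.exists_reroute (fun P => P.darts)
    (fun P _ => P.isWalk.isChain) g fun P _ a _ => (hg a).1
  refine ⟨F', h₁, h₂, fun Q hQ => ?_, fun x => ?_⟩
  · obtain ⟨P, hP, hf, hl, hle⟩ := h₃ Q hQ
    exact ⟨P, hP, hf, hl, hle.trans (List.sum_le_sum fun a _ => (hg a).2.2)⟩
  · have key : F'.onEdge x ≤ ∑ e, F.onEdge e * ((E.flow e).onEdge x / H.cap e) := by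
      refine (h₄ x).trans ?_
      simp only [MFlow.onEdge_eq F, ← MFlow.weigh_const_mul, ← MFlow.weigh_sum]
      refine MFlow.weigh_mono fun P _ => ?_
      rw [← SimplePath.sum_darts P fun e => (E.flow e).onEdge x / H.cap e]
      exact List.sum_le_sum fun a _ => (hg a).2.1 x
    refine ⟨key.trans ?_, key⟩
    rw [E.onEdge_total, Finset.mul_sum]
    refine Finset.sum_le_sum fun e _ => ?_
    calc F.onEdge e * ((E.flow e).onEdge x / H.cap e)
        ≤ F.congestion * H.cap e * ((E.flow e).onEdge x / H.cap e) :=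
          mul_le_mul_left (F.onEdge_le e) _
      _ = _ := by
          rw [mul_assoc, mul_div_cancel₀ _ (H.cap_pos e).ne']

/-- Embeddings of length slack `1` compose, and their congestions multiply. -/
lemma exists_comp (E₁ : Embedding K H) (E₂ : Embedding H G) (h₁ : E₁.HasLengthSlack 1)
    (h₂ : E₂.HasLengthSlack 1) :
    ∃ E : Embedding K G, E.HasLengthSlack 1 ∧
      E.total.congestion ≤ E₁.total.congestion * E₂.total.congestion := by
  choose f hd hv hs hf using fun k => E₂.exists_image (E₁.flow k)
  refine ⟨⟨f, fun e Q hQ => ?_, fun e => (hv e).trans (E₁.value e)⟩, fun e => ?_,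
    MFlow.congestion_le_iff.2 fun x => ?_⟩
  · obtain ⟨P, hP, ha, hb, -⟩ := hs e Q hQ
    rw [ha, hb]
    exact E₁.ends e P hP
  · refine MFlow.leng_le_iff.2 fun Q hQ => ?_
    obtain ⟨P, hP, -, -, hle⟩ := hs e Q hQ
    refine hle.trans (le_trans (List.sum_le_sum fun a _ => ?_)
      (MFlow.leng_le_iff.1 (h₁ e) P hP))
    simpa using h₂ a.1
  · rw [onEdge_total]
    calc ∑ k, (f k).onEdge x
        ≤ ∑ k, ∑ e, (E₁.flow k).onEdge e * ((E₂.flow e).onEdge x / H.cap e) :=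
          Finset.sum_le_sum fun k _ => (hf k x).2
      _ = ∑ e, E₁.total.onEdge e * ((E₂.flow e).onEdge x / H.cap e) := by
          rw [Finset.sum_comm]
          simp only [← Finset.sum_mul, onEdge_total]
      _ ≤ ∑ e, E₁.total.congestion * (E₂.flow e).onEdge x := by
          refine Finset.sum_le_sum fun e _ => ?_
          refine (mul_le_mul_left (E₁.total.onEdge_le e) _).trans (le_of_eq ?_)
          rw [mul_assoc, mul_div_cancel₀ _ (H.cap_pos e).ne']
      _ = E₁.total.congestion * E₂.total.onEdge x := by
          rw [← Finset.mul_sum, onEdge_total]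
      _ ≤ _ := by
          rw [mul_assoc]
          exact mul_le_mul_right (E₂.total.onEdge_le x) _

/-- An embedding of `H` into `G` extends to an embedding of `G ∪ H`, in which the edges of `G` are
routed along themselves. -/
lemma exists_union (E : Embedding H G) (hE : E.HasLengthSlack 1) :
    ∃ E' : Embedding (G.union H) G, E'.HasLengthSlack 1 ∧
      E'.total.congestion ≤ 1 + E.total.congestion := by
  choose R hR using fun e : Fin G.m => SimplePath.exists_dart (G := G) (e, true)
  have hsum : ∀ (e : Fin G.m) (x : Fin G.m), (R e).ind x ≤ if x = e then 1 else 0 := by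
    intro e x
    refine (SimplePath.ind_le_of_subset (s := [e]) (fun y hy => ?_) x).trans (by simp)
    simpa using ((hR e).2.2.map Prod.fst).subset hy
  refine ⟨⟨fun e => Fin.addCases (m := G.m) (n := H.m) (motive := fun _ => MFlow G)
    (fun e => Finsupp.single (R e) (G.cap e)) E.flow e, fun e => ?_, fun e => ?_⟩, fun e => ?_,
    MFlow.congestion_le_iff.2 fun x => ?_⟩
  · refine Fin.addCases (m := G.m) (n := H.m) (fun e => ?_) (fun e => ?_) e
    · rw [Fin.addCases_left, CapGraph.union_src_left, CapGraph.union_dst_left]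
      intro P hP
      obtain rfl : P = _ := by simpa using Finsupp.support_single_subset hP
      exact ⟨(hR e).1, (hR e).2.1⟩
    · rw [Fin.addCases_right, CapGraph.union_src_right, CapGraph.union_dst_right]
      exact E.ends e
  · refine Fin.addCases (m := G.m) (n := H.m) (fun e => ?_) (fun e => ?_) e
    · rw [Fin.addCases_left, CapGraph.union_cap_left, MFlow.val_eq]
      simp
    · rw [Fin.addCases_right, CapGraph.union_cap_right, E.value]
  · refine Fin.addCases (m := G.m) (n := H.m) (fun e => ?_) (fun e => ?_) e
    · rw [CapGraph.union_len_left]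
      dsimp only
      rw [Fin.addCases_left, MFlow.leng_le_iff]
      intro P hP
      obtain rfl : P = _ := by simpa using Finsupp.support_single_subset hP
      refine (SimplePath.length_le_of_sublist (hR e).2.2).trans (by simp)
    · rw [CapGraph.union_len_right]
      dsimp only
      rw [Fin.addCases_right]
      exact hE e
  · rw [onEdge_total, add_mul]
    refine (Fin.sum_univ_add (a := G.m) (b := H.m) _).le.trans ?_
    dsimp only
    simp only [Fin.addCases_left, Fin.addCases_right]
    refine add_le_add ?_ ?_
    · simp only [MFlow.onEdge_eq, MFlow.weigh_single]
      calc ∑ e, G.cap e * (R e).ind x ≤ ∑ e, G.cap e * (if x = e then 1 else 0) :=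
            Finset.sum_le_sum fun e _ => mul_le_mul_right (hsum e x) _
        _ = 1 * G.cap x := by simp
    · rw [← onEdge_total]
      exact E.total.onEdge_le x

end Embedding

end Embeddings

/-! ### Emulators -/

section Emulators

variable {n : ℕ} {G H : CapGraph n}

/-- Every demand respects some node-weighting, so an emulator for all node-weightings is one
without a restriction on demands. -/
lemma isEmulator_iff {G' : CapGraph n} {h t : ℕ} {s κ : ℝ≥0} :
    IsEmulator G G' h t s κ ↔ (∀ e, G'.len e = s * h) ∧
      (∀ F : MFlow G, F.leng ≤ h → ∃ F' : MFlow G', F'.demand = F.demand ∧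
        F'.congestion ≤ κ * F.congestion ∧ F'.step ≤ t) ∧
      ∃ E : Embedding G' G, E.total.congestion ≤ 1 ∧ E.HasLengthSlack 1 := by
  refine ⟨fun H => ⟨(H 0).uniform, fun F hF => ?_, (H 0).backward⟩,
    fun ⟨h₁, h₂, h₃⟩ A => ⟨h₁, fun F _ => h₂ F, h₃⟩⟩
  exact (H fun v => ∑ w, F.demand v w + ∑ w, F.demand w v).forward F
    (fun v => ⟨le_self_add, le_add_self⟩) hF

/-- Flows along paths without edges can be routed in every graph. -/
lemma exists_flow_of_darts_eq_nil (F : MFlow G) (hF : ∀ P ∈ F.support, P.darts = []) :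
    ∃ F' : MFlow H, F'.demand = F.demand ∧ F'.congestion = 0 ∧ F'.step = 0 := by
  obtain ⟨F', h₁, -, h₂, h₃⟩ := F.exists_reroute (G := H) (fun P => P.darts)
    (fun P _ => P.isWalk.isChain) (fun _ => 0) fun P hP a ha => by simp [hF P hP] at ha
  have hz : ∀ e, F'.onEdge e = 0 := fun e => by
    refine le_antisymm ((h₃ e).trans (le_of_eq ?_)) zero_le
    rw [MFlow.weigh_apply]
    exact Finset.sum_eq_zero fun P hP => by simp [hF P hP]
  refine ⟨F', h₁, le_antisymm (MFlow.congestion_le_iff.2 fun e => by simp [hz e]) zero_le,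
    le_antisymm (MFlow.step_le_iff.2 fun Q hQ => ?_) (Nat.zero_le _)⟩
  rw [SimplePath.steps, Nat.le_zero, List.length_eq_zero_iff]
  by_contra hne
  obtain ⟨a, ha⟩ := List.exists_mem_of_ne_nil _ hne
  have := hz a.1
  rw [MFlow.onEdge_eq, MFlow.weigh_apply, Finset.sum_eq_zero_iff] at this
  have h := this Q hQ
  rw [SimplePath.ind, if_pos (List.mem_map_of_mem ha), mul_one] at h
  exact Finsupp.mem_support_iff.1 hQ h

/-- A single edge of unit capacity and length. -/
def edgeGraph (v w : Fin n) : CapGraph n where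
  m := 1
  src := fun _ => v
  dst := fun _ => w
  cap := fun _ => 1
  len := fun _ => 1
  cap_pos := fun _ => one_pos
  len_pos := fun _ => one_pos

lemma SimplePath.darts_ne_nil {P : SimplePath G} (h : P.first ≠ P.last) : P.darts ≠ [] := by
  intro h0
  have := P.isWalk
  rw [h0] at this
  exact h this

/-- Emulating a single edge already needs slacks of at least `1`. -/
lemma one_le_slacks {v w : Fin n} (hvw : v ≠ w) {H : CapGraph n} {t : ℕ} {s κ : ℝ≥0}
    (hH : IsEmulator (edgeGraph v w) H 1 t s κ) : 1 ≤ s ∧ 1 ≤ κ := by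
  classical
  obtain ⟨hu, hf, E, hE, hE'⟩ := isEmulator_iff.1 hH
  obtain ⟨e₀, he₀⟩ : ∃ e₀ : Fin (edgeGraph v w).m, ∀ e, e = e₀ :=
    ⟨(0 : Fin 1), fun e => Subsingleton.elim (α := Fin 1) _ _⟩
  let P : SimplePath (edgeGraph v w) := ⟨v, w, [(e₀, true)], ⟨rfl, rfl⟩, by
    simpa [CapGraph.head, edgeGraph] using hvw⟩
  obtain ⟨F', hd, hc, -⟩ := hf (Finsupp.single P 1) (by
    rw [MFlow.leng_le_iff]
    intro Q hQ
    obtain rfl : Q = P := by simpa using Finsupp.support_single_subset hQ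
    simp [SimplePath.length, P, edgeGraph])
  have hd1 : F'.demand v w = 1 := by
    rw [hd, MFlow.demand_eq, MFlow.weigh_single]
    simp [P]
  have hc1 : MFlow.congestion (Finsupp.single P 1) ≤ 1 := by
    rw [MFlow.congestion_le_iff]
    intro e
    rw [MFlow.onEdge_eq, MFlow.weigh_single]
    simpa [edgeGraph] using P.ind_le_one e
  constructor
  · -- the first edge of a flow-path from `v` to `w` is not a loop
    have : ∃ Q ∈ F'.support, Q.first = v ∧ Q.last = w := by
      by_contra! hne
      rw [MFlow.demand, Finset.sum_eq_zero] at hd1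
      · exact zero_ne_one hd1
      · intro Q hQ
        rw [Finset.mem_filter] at hQ
        exact absurd hQ.2.2 (hne Q hQ.1 hQ.2.1)
    obtain ⟨Q, hQ, rfl, rfl⟩ := this
    obtain ⟨a, l, hal⟩ := List.exists_cons_of_ne_nil (SimplePath.darts_ne_nil hvw)
    have hw := Q.isWalk
    have hn := Q.nodup
    rw [hal] at hw hn
    have hne : H.src a.1 ≠ H.dst a.1 := by
      intro h
      have h' : H.tail a = H.head a := by
        unfold CapGraph.tail CapGraph.head
        rw [h]
      rw [hw.1] at h'
      simp [h'] at hn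
    have hsup : (E.flow a.1).support.Nonempty := by
      rw [Finset.nonempty_iff_ne_empty]
      intro h
      have := E.value a.1
      rw [MFlow.val, h, Finset.sum_empty] at this
      exact (H.cap_pos a.1).ne this
    obtain ⟨R, hR⟩ := hsup
    have hRn : R.darts ≠ [] := by
      refine SimplePath.darts_ne_nil ?_
      rwa [(E.ends _ R hR).1, (E.ends _ R hR).2]
    have h1 : 1 ≤ R.length := by
      have : R.length = R.darts.length := by
        simp [SimplePath.length, edgeGraph]
      rw [this]
      exact_mod_cast List.length_pos_iff.2 hRn
    have := h1.trans (MFlow.leng_le_iff.1 (hE' a.1) R hR)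
    simpa [hu] using this
  · obtain ⟨F'', hd'', -, -, hx⟩ := E.exists_image F'
    have h1 : (1 : ℝ≥0) ≤ F''.onEdge e₀ := by
      rw [← hd1, ← hd'', MFlow.demand_eq, MFlow.onEdge_eq]
      refine MFlow.weigh_mono fun Q _ => ?_
      split_ifs with h
      · have hne : Q.darts ≠ [] := SimplePath.darts_ne_nil (by rw [h.1, h.2]; exact hvw)
        obtain ⟨a, ha⟩ := List.exists_mem_of_ne_nil _ hne
        rw [SimplePath.ind, if_pos]
        rw [← he₀ a.1]
        exact List.mem_map_of_mem ha
      · exact zero_le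
    have h2 : E.total.onEdge e₀ ≤ 1 := by
      refine (E.total.onEdge_le _).trans ?_
      simpa [edgeGraph] using hE
    calc (1 : ℝ≥0) ≤ F'.congestion * E.total.onEdge e₀ := h1.trans (hx _).1
      _ ≤ (κ * 1) * 1 := by gcongr; exact hc.trans (by gcongr)
      _ = κ := by simp

end Emulators

/-! ### The graph of one bootstrapping stage -/

section Stage

variable {n : ℕ}

/-- The edges of `G ∪ G'` that take part in a stage: the edges of `G` with length in `(lo, hi]` and
all edges of `G'`. -/
def stageEdges (G G' : CapGraph n) (lo hi : ℝ≥0) : List (Fin (G.union G').m) :=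
  ((List.finRange G.m).filter fun e => decide (lo < G.len e ∧ G.len e ≤ hi)).map
      (Fin.castAdd G'.m) ++
    (List.finRange G'.m).map (Fin.natAdd G.m)

/-- The rescaled lengths of a stage: lengths of edges of `G` are measured in units of `δ` and
rounded up, and edges of `G'` have length `1`. The maximum only matters for `δ = 0`. -/
def stageLen (G G' : CapGraph n) (δ : ℝ≥0) : Fin (G.union G').m → ℝ≥0 :=
  Fin.append (fun e => max 1 (⌈G.len e / δ⌉₊ : ℝ≥0)) (fun _ : Fin G'.m => 1)

variable {G G' : CapGraph n} {lo hi δ : ℝ≥0}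

lemma stageLen_left (e : Fin G.m) :
    stageLen G G' δ (Fin.castAdd G'.m e) = max 1 (⌈G.len e / δ⌉₊ : ℝ≥0) :=
  Fin.append_left _ _ _

lemma stageLen_right (e : Fin G'.m) : stageLen G G' δ (Fin.natAdd G.m e) = 1 :=
  Fin.append_right _ _ _

lemma one_le_stageLen (e : Fin (G.union G').m) : 1 ≤ stageLen G G' δ e := by
  refine Fin.addCases (m := G.m) (n := G'.m) (fun e => ?_) (fun e => ?_) e
  · exact (stageLen_left e).symm ▸ le_max_left _ _
  · exact (stageLen_right e).ge

/-- The graph whose emulator is computed in a stage. Its capacities are halved, so that routing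
through `G` and through (the embedding of) `G'` together does not exceed the capacities of `G`. -/
def stage (G G' : CapGraph n) (lo hi δ : ℝ≥0) : CapGraph n where
  m := (stageEdges G G' lo hi).length
  src e := (G.union G').src ((stageEdges G G' lo hi).get e)
  dst e := (G.union G').dst ((stageEdges G G' lo hi).get e)
  cap e := (G.union G').cap ((stageEdges G G' lo hi).get e) / 2
  len e := stageLen G G' δ ((stageEdges G G' lo hi).get e)
  cap_pos _ := half_pos ((G.union G').cap_pos _)
  len_pos _ := one_pos.trans_le (one_le_stageLen _)

/-- The edge of `G ∪ G'` behind an edge of the stage. -/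
def stageEdge (e : Fin (stage G G' lo hi δ).m) : Fin (G.union G').m :=
  (stageEdges G G' lo hi).get e

lemma stage_src (e : Fin (stage G G' lo hi δ).m) :
    (G.union G').src (stageEdge e) = (stage G G' lo hi δ).src e := rfl

lemma stage_dst (e : Fin (stage G G' lo hi δ).m) :
    (G.union G').dst (stageEdge e) = (stage G G' lo hi δ).dst e := rfl

lemma stage_cap (e : Fin (stage G G' lo hi δ).m) :
    (stage G G' lo hi δ).cap e = (G.union G').cap (stageEdge e) / 2 := rfl

lemma stage_len (e : Fin (stage G G' lo hi δ).m) :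
    (stage G G' lo hi δ).len e = stageLen G G' δ (stageEdge e) := rfl

lemma castAdd_ne_natAdd {a b : ℕ} (i : Fin a) (j : Fin b) : Fin.castAdd b i ≠ Fin.natAdd a j := by
  intro h
  have := congrArg Fin.val h
  simp only [Fin.val_castAdd, Fin.val_natAdd] at this
  omega

lemma stageEdge_injective :
    Function.Injective (stageEdge : Fin (stage G G' lo hi δ).m → Fin (G.union G').m) := by
  refine List.nodup_iff_injective_get.1 ?_
  refine List.Nodup.append ?_ ?_ ?_
  · exact ((List.nodup_finRange _).filter _).map (Fin.castAdd_injective _ _)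
  · exact (List.nodup_finRange _).map (Fin.natAdd_injective _ _)
  · intro x hx hx'
    obtain ⟨i, -, rfl⟩ := List.mem_map.1 hx
    obtain ⟨j, -, hj⟩ := List.mem_map.1 hx'
    exact castAdd_ne_natAdd i j hj.symm

lemma exists_stageEdge_left {e : Fin G.m} (h₁ : lo < G.len e) (h₂ : G.len e ≤ hi) :
    ∃ x : Fin (stage G G' lo hi δ).m, stageEdge x = Fin.castAdd G'.m e := by
  refine List.mem_iff_get.1 (List.mem_append_left _ (List.mem_map_of_mem ?_))
  simp [h₁, h₂]

lemma exists_stageEdge_right (e : Fin G'.m) :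
    ∃ x : Fin (stage G G' lo hi δ).m, stageEdge x = Fin.natAdd G.m e :=
  List.mem_iff_get.1 (List.mem_append_right _ (List.mem_map_of_mem (List.mem_finRange e)))

lemma mem_range_of_stageEdge {x : Fin (stage G G' lo hi δ).m} {e : Fin G.m}
    (h : stageEdge x = Fin.castAdd G'.m e) : lo < G.len e ∧ G.len e ≤ hi := by
  have hx : Fin.castAdd G'.m e ∈ stageEdges G G' lo hi := h ▸ List.get_mem _ _
  rcases List.mem_append.1 hx with hx | hx
  · obtain ⟨i, hi, hie⟩ := List.mem_map.1 hx
    obtain rfl := Fin.castAdd_injective _ _ hie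
    simpa using hi
  · obtain ⟨j, -, hj⟩ := List.mem_map.1 hx
    exact absurd hj.symm (castAdd_ne_natAdd e j)

lemma stage_m_le : (stage G G' lo hi δ).m ≤ G.m + G'.m := by
  refine (List.length_append).le.trans (add_le_add ?_ ?_)
  · exact (List.length_map _).le.trans ((List.length_filter_le _ _).trans List.length_finRange.le)
  · exact (List.length_map _).le.trans List.length_finRange.le

lemma stage_integral : (stage G G' lo hi δ).Integral := by
  intro e
  rw [stage_len]
  refine Fin.addCases (m := G.m) (n := G'.m) (fun e => ?_) (fun e => ?_) (stageEdge e)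
  · rw [stageLen_left]
    exact ⟨max 1 ⌈G.len e / δ⌉₊, by push_cast; rfl⟩
  · rw [stageLen_right]
    exact ⟨1, by simp⟩

/-! ### Cutting paths into segments -/

/-- A segment of a path: a simple path (which will be short), or a single traversed edge. -/
abbrev Seg (G : CapGraph n) : Type := SimplePath G ⊕ (Fin G.m × Bool)

namespace Seg

/-- The first vertex of a segment. -/
def st : Seg G → Fin n := Sum.elim SimplePath.first G.tail
/-- The last vertex of a segment. -/
def en : Seg G → Fin n := Sum.elim SimplePath.last G.head
/-- The traversed edges of a segment. -/
def darts : Seg G → List (Fin G.m × Bool) := Sum.elim SimplePath.darts fun a => [a]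

end Seg

/-- Cutting a path greedily from its end: an edge longer than `δ` is a segment of its own, and a
short edge is added to the first segment unless that would make it longer than `δ`. Whenever a
short segment is closed, the next edge overfills it, so if `k` of them have been closed, `k * δ` is
less than twice the length of the path. -/
lemma exists_segments_aux (δ : ℝ≥0) {l : List (Fin G.m × Bool)} : ∀ {v w : Fin n},
    G.IsWalk v w l → (v :: l.map G.head).Nodup →
    ∃ (q : SimplePath G) (r : List (Seg G)), q.first = v ∧ IsChain Seg.st Seg.en q.last w r ∧
      q.darts ++ r.flatMap Seg.darts = l ∧ q.length ≤ δ ∧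
      (∀ p, Sum.inl p ∈ r → p.length ≤ δ) ∧ (∀ a, Sum.inr a ∈ r → δ < G.len a.1) ∧
      ((r.countP Sum.isLeft = 0 ∧ q.length ≤ 2 * (l.map fun a => G.len a.1).sum) ∨
        (r.countP Sum.isLeft : ℝ≥0) * δ + q.length < 2 * (l.map fun a => G.len a.1).sum) := by
  induction l with
  | nil =>
    rintro v w rfl -
    exact ⟨SimplePath.trivial G v, [], rfl, rfl, rfl, zero_le, by simp, by simp, Or.inl (by
      simp [SimplePath.length, SimplePath.trivial])⟩
  | cons a l ih =>
    rintro v w ⟨h₁, h₂⟩ hn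
    obtain ⟨q, r, hq, hr, hqr, hqδ, hrs, hrl, hk⟩ := ih h₂ (List.nodup_cons.1 hn).2
    have ha := G.len_pos a.1
    rw [List.map_cons, List.sum_cons]
    generalize (l.map fun a => G.len a.1).sum = L at hk ⊢
    by_cases hlong : δ < G.len a.1
    · -- close the current segment, and start with an empty one in front of the long edge
      refine ⟨SimplePath.trivial G v, Sum.inr a :: Sum.inl q :: r, rfl, ⟨h₁, hq, hr⟩, ?_, zero_le,
        ?_, ?_, Or.inr ?_⟩
      · simp [SimplePath.trivial, Seg.darts, ← hqr]
      · rintro p hp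
        rcases List.mem_cons.1 hp with h | h
        · cases h
        · rcases List.mem_cons.1 h with h | h
          · cases h; exact hqδ
          · exact hrs p h
      · rintro b hb
        rcases List.mem_cons.1 hb with h | h
        · cases h; exact hlong
        · rcases List.mem_cons.1 h with h | h
          · cases h
          · exact hrl b h
      · have : (SimplePath.trivial G v).length = 0 := rfl
        rw [this]
        simp only [List.countP_cons, Sum.isLeft, Nat.cast_add]
        simp only [← NNReal.coe_lt_coe, ← NNReal.coe_le_coe] at hk ha hlong ⊢
        push_cast at *
        have := q.length.coe_nonneg
        have := L.coe_nonneg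
        rcases hk with ⟨h0, -⟩ | hk
        · rw [h0]; push_cast; norm_num; linarith
        · norm_num; linarith
    · by_cases hfit : G.len a.1 + q.length ≤ δ
      · refine ⟨⟨v, q.last, a :: q.darts, ⟨h₁, by rw [← hq]; exact q.isWalk⟩, ?_⟩, r, rfl, hr,
          ?_, ?_, hrs, hrl, ?_⟩
        · refine hn.sublist ((List.Sublist.cons_cons a ?_).map _ |>.cons_cons v)
          rw [← hqr]
          exact List.sublist_append_left _ _
        · simp [← hqr]
        · simpa [SimplePath.length] using hfit
        · simp only [SimplePath.length, List.map_cons, List.sum_cons] at hk ⊢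
          rcases hk with ⟨h0, hk⟩ | hk
          · left
            refine ⟨h0, ?_⟩
            rw [mul_add, two_mul (G.len a.1)]
            exact add_le_add le_self_add hk
          · right
            rw [mul_add, two_mul (G.len a.1), add_left_comm]
            exact add_lt_add_of_le_of_lt le_self_add hk
      · obtain ⟨p, hp₁, hp₂, hp₃⟩ : ∃ p : SimplePath G, p.first = v ∧ p.last = G.head a ∧
            p.darts = [a] := ⟨⟨v, G.head a, [a], ⟨h₁, rfl⟩, hn.sublist
              ((List.Sublist.cons_cons a (List.nil_sublist _)).map _ |>.cons_cons v)⟩,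
            rfl, rfl, rfl⟩
        have hpl : p.length = G.len a.1 := by simp [SimplePath.length, hp₃]
        refine ⟨p, Sum.inl q :: r, hp₁, ⟨hq.trans hp₂.symm, hr⟩, ?_, ?_, ?_, ?_, Or.inr ?_⟩
        · simp [Seg.darts, ← hqr, hp₃]
        · rw [hpl]
          exact not_lt.1 hlong
        · rintro p hp
          rcases List.mem_cons.1 hp with h | h
          · cases h; exact hqδ
          · exact hrs p h
        · rintro b hb
          rcases List.mem_cons.1 hb with h | h
          · cases h
          · exact hrl b h
        · rw [hpl]
          simp only [List.countP_cons, Sum.isLeft, Nat.cast_add]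
          simp only [not_le] at hfit
          simp only [← NNReal.coe_lt_coe, ← NNReal.coe_le_coe] at hk ha hfit ⊢
          push_cast at *
          have := q.length.coe_nonneg
          have := L.coe_nonneg
          rcases hk with ⟨h0, hk⟩ | hk
          · rw [h0]; push_cast; norm_num; linarith
          · linarith

/-- A path of length at most `h * δ` is cut into at most `2 * h` segments of length at most `δ` and
edges longer than `δ`. -/
lemma exists_segments {h : ℕ} (hh : 1 ≤ h) {δ : ℝ≥0} (P : SimplePath G) (hP : P.length ≤ h * δ) :
    ∃ r : List (Seg G), IsChain Seg.st Seg.en P.first P.last r ∧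
      r.flatMap Seg.darts = P.darts ∧ (∀ p, Sum.inl p ∈ r → p.length ≤ δ) ∧
      (∀ a, Sum.inr a ∈ r → δ < G.len a.1) ∧ r.countP Sum.isLeft ≤ 2 * h := by
  obtain ⟨q, r, h₁, h₂, h₃, h₄, h₅, h₆, h₇⟩ := exists_segments_aux δ P.isWalk P.nodup
  refine ⟨Sum.inl q :: r, ⟨h₁, h₂⟩, h₃, fun p hp => ?_, fun a ha => ?_, ?_⟩
  · rcases List.mem_cons.1 hp with h | h
    · cases h; exact h₄
    · exact h₅ p h
  · rcases List.mem_cons.1 ha with h | h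
    · cases h
    · exact h₆ a h
  · rw [List.countP_cons_of_pos (by rfl)]
    rcases h₇ with ⟨h₀, -⟩ | h₇
    · omega
    · have h₈ : (r.countP Sum.isLeft : ℝ≥0) * δ < ((2 * h : ℕ) : ℝ≥0) * δ := by
        refine (le_self_add.trans_lt h₇).trans_le ?_
        push_cast
        rw [mul_assoc]
        exact mul_le_mul_right hP _
      have := Nat.cast_lt.1 (lt_of_mul_lt_mul_right h₈ zero_le)
      omega

lemma sum_indicator_flatMap {α β : Type*} [DecidableEq β] (f : α → List β) (e : β) {l : List α}
    (h : (l.flatMap f).Nodup) :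
    (l.map fun x => if e ∈ f x then (1 : ℝ≥0) else 0).sum = if e ∈ l.flatMap f then 1 else 0 := by
  induction l with
  | nil => simp
  | cons x l ih =>
    rw [List.flatMap_cons] at h
    obtain ⟨-, h₂, h₃⟩ := List.nodup_append'.1 h
    rw [List.map_cons, List.sum_cons, ih h₂]
    by_cases hx : e ∈ f x
    · have : e ∉ l.flatMap f := h₃ hx
      simp only [List.flatMap_cons, List.mem_append, hx, this, true_or, if_true, if_false, add_zero]
    · simp only [List.flatMap_cons, List.mem_append]
      simp [hx]

/-- Every edge of a path lies on exactly one of its segments. -/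
lemma sum_segments {P : SimplePath G} {r : List (Seg G)} (hr : r.flatMap Seg.darts = P.darts)
    (e : Fin G.m) :
    (r.map fun x => if e ∈ x.darts.map Prod.fst then (1 : ℝ≥0) else 0).sum = P.ind e := by
  have h : r.flatMap (fun x => x.darts.map Prod.fst) = P.darts.map Prod.fst := by
    rw [← hr, List.map_flatMap]
  rw [sum_indicator_flatMap _ e (h ▸ P.nodup_edges), h]
  rfl

/-! ### Routing through one stage -/

namespace MFlow

lemma weigh_filter (c : SimplePath G → ℝ≥0) (F : MFlow G) (p : SimplePath G → Prop)
    [DecidablePred p] :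
    weigh c (F.filter p : MFlow G) = weigh (fun P => if p P then c P else 0) F := by
  rw [weigh_apply, weigh_apply, Finsupp.support_filter, Finset.sum_filter]
  refine Finset.sum_congr rfl fun P _ => ?_
  split_ifs with h
  · rw [Finsupp.filter_apply_pos _ _ h]
  · simp

/-- The flow along the short segments of the flow-paths of `F`. -/
def shortPart (F : MFlow G) (items : SimplePath G → List (Seg G)) : MFlow G :=
  ∑ P ∈ F.support,
    F P • ((items P).map (Sum.elim (fun q => (Finsupp.single q 1 : MFlow G)) fun _ => 0)).sum

lemma weigh_shortPart (c : SimplePath G → ℝ≥0) (F : MFlow G)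
    (items : SimplePath G → List (Seg G)) :
    weigh c (F.shortPart items) =
      weigh (fun P => ((items P).map (Sum.elim c fun _ => 0)).sum) F := by
  rw [shortPart, map_sum, weigh_apply]
  refine Finset.sum_congr rfl fun P _ => ?_
  rw [map_smul, smul_eq_mul, map_list_sum, List.map_map]
  congr 3
  funext x
  rcases x with q | a <;> simp

end MFlow

open MFlow in
/-- If `G'` routes all flows of length at most `lo`, then a flow `F` whose flow-paths are cut into
segments is routed in the stage by sending long edges along themselves, and short segments through
`G'`: all short segments with the same ends share the flow-paths that `G'` has for these ends, in
proportion to their values. -/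
lemma exists_stage_flow {κ' : ℝ≥0} {t : ℕ} (hκ : 1 ≤ κ')
    (hfwd : ∀ F : MFlow G, F.leng ≤ lo → ∃ F' : MFlow G', F'.demand = F.demand ∧
      F'.congestion ≤ κ' * F.congestion ∧ F'.step ≤ t)
    (F : MFlow G) (items : SimplePath G → List (Seg G)) (B : ℝ≥0)
    (hchain : ∀ P ∈ F.support, IsChain Seg.st Seg.en P.first P.last (items P))
    (hdarts : ∀ P ∈ F.support, (items P).flatMap Seg.darts = P.darts)
    (hshort : ∀ P ∈ F.support, ∀ q, Sum.inl q ∈ items P → q.length ≤ lo)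
    (hlong : ∀ P ∈ F.support, ∀ a, Sum.inr a ∈ items P → lo < G.len a.1 ∧ G.len a.1 ≤ hi)
    (hB : ∀ P ∈ F.support, ((items P).map (Sum.elim (fun _ => (t : ℝ≥0))
      fun a => stageLen G G' δ (Fin.castAdd G'.m a.1))).sum ≤ B) :
    ∃ F' : MFlow (stage G G' lo hi δ), F'.demand = F.demand ∧
      F'.congestion ≤ 2 * κ' * F.congestion ∧ F'.leng ≤ B := by
  classical
  set H := stage G G' lo hi δ with hH
  set S := F.shortPart items with hS
  -- the short part congests `G` no more than `F` does
  have hSedge : ∀ e, S.onEdge e ≤ F.onEdge e := by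
    intro e
    rw [onEdge_eq, onEdge_eq, hS, weigh_shortPart]
    refine weigh_mono fun P hP => ?_
    rw [← sum_segments (hdarts P hP) e]
    refine List.sum_le_sum fun x _ => ?_
    rcases x with q | a
    · exact le_rfl
    · exact zero_le
  have hScong : S.congestion ≤ F.congestion :=
    congestion_le_iff.2 fun e => (hSedge e).trans (F.onEdge_le e)
  have hSleng : S.leng ≤ lo := by
    rw [leng_le_iff]
    intro Q hQ
    have hw : weigh (fun R => if R = Q then 1 else 0) S ≠ 0 := by
      rw [weigh_apply]
      simpa using hQ
    rw [hS, weigh_shortPart, weigh_apply] at hw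
    obtain ⟨P, hP, hw⟩ := Finset.exists_ne_zero_of_sum_ne_zero hw
    have hw := right_ne_zero_of_mul hw
    have : ∃ x ∈ items P,
        Sum.elim (fun R => if R = Q then (1 : ℝ≥0) else 0) (fun _ => 0) x ≠ 0 := by
      by_contra! h
      exact hw (List.sum_eq_zero fun y hy => by
        obtain ⟨x, hx, rfl⟩ := List.mem_map.1 hy
        exact h x hx)
    obtain ⟨x, hx, hne⟩ := this
    rcases x with q | a
    · obtain rfl : q = Q := by by_contra hqQ; simp [hqQ] at hne
      exact hshort P hP q hx
    · simp at hne
  obtain ⟨S', hS'd, hS'c, hS't⟩ := hfwd S hSleng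
  -- the embeddings of `G'` and of the long edges into the stage
  choose ψ hψ using fun y => exists_stageEdge_right (G := G) (G' := G') (lo := lo) (hi := hi)
    (δ := δ) y
  have hψs : ∀ y, H.src (ψ y) = G'.src y := fun y => by
    rw [← stage_src, hψ, CapGraph.union_src_right]
  have hψd : ∀ y, H.dst (ψ y) = G'.dst y := fun y => by
    rw [← stage_dst, hψ, CapGraph.union_dst_right]
  have hψi : Function.Injective ψ := fun y y' h =>
    Fin.natAdd_injective _ _ (by rw [← hψ, ← hψ, h])
  have hR : ∀ a : Fin G.m × Bool, ∃ R : SimplePath H, lo < G.len a.1 → G.len a.1 ≤ hi →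
      R.first = G.tail a ∧ R.last = G.head a ∧
      ∃ z : Fin H.m, stageEdge z = Fin.castAdd G'.m a.1 ∧ R.darts.Sublist [(z, a.2)] := by
    intro a
    by_cases h : lo < G.len a.1 ∧ G.len a.1 ≤ hi
    · obtain ⟨z, hz⟩ := exists_stageEdge_left (G' := G') (δ := δ) h.1 h.2
      obtain ⟨R, h₁, h₂, h₃⟩ := SimplePath.exists_dart (G := H) (z, a.2)
      have hs : H.src z = G.src a.1 := by rw [← stage_src, hz, CapGraph.union_src_left]
      have hd : H.dst z = G.dst a.1 := by rw [← stage_dst, hz, CapGraph.union_dst_left]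
      refine ⟨R, fun _ _ => ⟨h₁.trans ?_, h₂.trans ?_, z, hz, h₃⟩⟩
      · simp [CapGraph.tail, hs, hd]
      · simp [CapGraph.head, hs, hd]
    · exact ⟨SimplePath.trivial H (G.tail a), fun h₁ h₂ => absurd ⟨h₁, h₂⟩ h⟩
  choose R hR using hR
  -- the flow-paths of `S'` with given ends
  let N : Fin n → Fin n → MFlow G' := fun v w => S'.filter fun P => P.first = v ∧ P.last = w
  have hNval : ∀ v w, weigh (fun _ => 1) (N v w) = S.demand v w := by
    intro v w
    rw [weigh_filter, ← hS'd, demand_eq]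
  let g : Seg G → MFlow H := Sum.elim
    (fun q => (S.demand q.first q.last)⁻¹ •
      (Finsupp.mapDomain (SimplePath.map ψ hψs hψd) (N q.first q.last) : MFlow H))
    fun a => Finsupp.single (R a) 1
  have hpos : ∀ P ∈ F.support, ∀ q, Sum.inl q ∈ items P → S.demand q.first q.last ≠ 0 := by
    intro P hP q hq h0
    rw [demand_eq, hS, weigh_shortPart, weigh_apply, Finset.sum_eq_zero_iff] at h0
    have h1 := (mul_eq_zero.1 (h0 P hP)).resolve_left (Finsupp.mem_support_iff.1 hP)
    have h2 := List.sum_eq_zero_iff.1 h1 _ (List.mem_map_of_mem hq)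
    simp at h2
  have hgsupp : ∀ q, ∀ Q ∈ (g (Sum.inl q)).support, ∃ Q' ∈ S'.support,
      Q'.first = q.first ∧ Q'.last = q.last ∧ Q = SimplePath.map ψ hψs hψd Q' := by
    intro q Q hQ
    obtain ⟨Q', hQ', rfl⟩ := Finset.mem_image.1
      (Finsupp.mapDomain_support (Finsupp.support_smul hQ))
    rw [Finsupp.support_filter, Finset.mem_filter] at hQ'
    exact ⟨Q', hQ'.1, hQ'.2.1, hQ'.2.2, rfl⟩
  obtain ⟨F', hF'd, -, hF'l, hF'e⟩ := F.exists_reroute items hchain g (by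
    intro P hP x hx
    rcases x with q | a
    · refine ⟨fun Q hQ => ?_, ?_⟩
      · obtain ⟨Q', -, h₁, h₂, rfl⟩ := hgsupp q Q hQ
        exact ⟨h₁, h₂⟩
      · simp only [g, Sum.elim_inl]
        rw [val_eq, map_smul, weigh_mapDomain, hNval, smul_eq_mul]
        exact inv_mul_cancel₀ (hpos P hP q hx)
    · obtain ⟨h₁, h₂⟩ := hlong P hP a hx
      have h := isUnit_single (R a)
      rwa [(hR a h₁ h₂).1, (hR a h₁ h₂).2.1] at h)
  refine ⟨F', hF'd, congestion_le_iff.2 fun z => (hF'e z).trans ?_, leng_le_iff.2 fun Q hQ => ?_⟩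
  · have hz : (∃ e, stageEdge z = Fin.castAdd G'.m e) ∨ ∃ y, stageEdge z = Fin.natAdd G.m y :=
      Fin.addCases (m := G.m) (n := G'.m) (motive := fun x =>
        (∃ e, x = Fin.castAdd G'.m e) ∨ ∃ y, x = Fin.natAdd G.m y)
        (fun e => Or.inl ⟨e, rfl⟩) (fun y => Or.inr ⟨y, rfl⟩) (stageEdge z)
    rcases hz with ⟨e, hz⟩ | ⟨y, hz⟩
    · -- an edge of `G` only carries the long segments that consist of this edge
      calc weigh (fun P => ((items P).map fun x => (g x).onEdge z).sum) F
          ≤ F.onEdge e := by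
            rw [onEdge_eq]
            refine weigh_mono fun P hP => ?_
            rw [← sum_segments (hdarts P hP) e]
            refine List.sum_le_sum fun x hx => ?_
            rcases x with q | a
            · refine le_trans (le_of_eq ?_) zero_le
              simp only [g, Sum.elim_inl]
              rw [onEdge_eq, map_smul, weigh_mapDomain, weigh_apply, Finset.sum_eq_zero, smul_zero]
              intro Q _
              rw [SimplePath.ind_map_eq_zero, mul_zero]
              intro y hy
              rw [← hy, hψ] at hz
              exact castAdd_ne_natAdd _ _ hz.symm
            · obtain ⟨h₁, h₂⟩ := hlong P hP a hx
              obtain ⟨-, -, z', hz', hs⟩ := hR a h₁ h₂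
              simp only [g, Sum.elim_inr]
              rw [onEdge_eq, weigh_single, one_mul]
              by_cases hzz : z = z'
              · subst hzz
                obtain rfl := Fin.castAdd_injective _ _ (hz'.symm.trans hz)
                simpa [Seg.darts] using SimplePath.ind_le_one _ _
              · refine le_trans (le_of_eq ?_) zero_le
                rw [SimplePath.ind, if_neg]
                intro h
                exact hzz (by simpa using (hs.map Prod.fst).subset h)
        _ ≤ F.congestion * G.cap e := F.onEdge_le e
        _ = 2 * 1 * F.congestion * H.cap z := by
            rw [stage_cap, hz, CapGraph.union_cap_left]
            field_simp
        _ ≤ _ := by gcongr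
    · -- an edge of `G'` carries what it carries in `S'`
      obtain rfl : ψ y = z := stageEdge_injective ((hψ y).trans hz.symm)
      calc weigh (fun P => ((items P).map fun x => (g x).onEdge (ψ y)).sum) F
          ≤ weigh (fun Q => (S.demand Q.first Q.last)⁻¹ *
              (N Q.first Q.last).onEdge y) S := by
            rw [hS, weigh_shortPart, ← hS]
            refine weigh_mono fun P hP => List.sum_le_sum fun x hx => ?_
            rcases x with q | a
            · refine le_of_eq ?_
              simp only [g, Sum.elim_inl]
              rw [onEdge_eq, map_smul, weigh_mapDomain, onEdge_eq, smul_eq_mul]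
              simp only [SimplePath.ind_map hψi]
            · obtain ⟨h₁, h₂⟩ := hlong P hP a hx
              obtain ⟨-, -, z', hz', hs⟩ := hR a h₁ h₂
              simp only [g, Sum.elim_inr]
              rw [onEdge_eq, weigh_single, one_mul, SimplePath.ind, if_neg]
              intro h
              have h : ψ y = z' := by simpa using (hs.map Prod.fst).subset h
              rw [← h, hψ] at hz'
              exact castAdd_ne_natAdd _ _ hz'.symm
        _ = ∑ v, ∑ w, S.demand v w * ((S.demand v w)⁻¹ * (N v w).onEdge y) :=
            weigh_ends (fun v w => (S.demand v w)⁻¹ * (N v w).onEdge y) S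
        _ ≤ ∑ v, ∑ w, (N v w).onEdge y := by
            refine Finset.sum_le_sum fun v _ => Finset.sum_le_sum fun w _ => ?_
            rw [← mul_assoc]
            exact mul_le_of_le_one_left zero_le mul_inv_le_one
        _ = S'.onEdge y := by
            simp only [N, onEdge_eq, weigh_filter, ← weigh_sum]
            congr 2
            funext P
            simp [ite_and]
        _ ≤ S'.congestion * G'.cap y := S'.onEdge_le y
        _ ≤ κ' * F.congestion * G'.cap y := by
            gcongr
            exact hS'c.trans (by gcongr)
        _ = _ := by
            rw [stage_cap, hψ, CapGraph.union_cap_right]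
            field_simp
  · obtain ⟨P, hP, -, -, hle⟩ := hF'l Q hQ
    refine hle.trans (le_trans (List.sum_le_sum fun x hx => ?_) (hB P hP))
    rcases x with q | a
    · rw [leng_le_iff]
      intro Q hQ
      obtain ⟨Q', hQ', -, -, rfl⟩ := hgsupp q Q hQ
      have : (SimplePath.map ψ hψs hψd Q').length = Q'.steps := by
        simp [SimplePath.length, SimplePath.map, SimplePath.steps, Function.comp_def, stage_len, hψ,
          stageLen_right]
      rw [this]
      exact Nat.cast_le.2 (step_le_iff.1 hS't Q' hQ')
    · obtain ⟨h₁, h₂⟩ := hlong P hP a hx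
      obtain ⟨-, -, z', hz', hs⟩ := hR a h₁ h₂
      rw [leng_le_iff]
      intro Q hQ
      obtain rfl : Q = R a := by simpa [g] using Finsupp.support_single_subset hQ
      refine (SimplePath.length_le_of_sublist hs).trans ?_
      simp only [List.map_cons, List.map_nil, List.sum_cons, List.sum_nil, add_zero]
      rw [stage_len, hz']
      rfl

end Stage

section Sequence

variable {n : ℕ}

/-! ### From the emulator of a stage to an emulator of the graph -/

/-- The graph `H` with all edge lengths replaced by `x` (by `1` if `x = 0`). -/
def CapGraph.withLen (H : CapGraph n) (x : ℝ≥0) : CapGraph n where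
  m := H.m
  src := H.src
  dst := H.dst
  cap := H.cap
  len _ := if 0 < x then x else 1
  cap_pos := H.cap_pos
  len_pos _ := by split_ifs with h; exacts [h, one_pos]

lemma MFlow.exists_withLen {H : CapGraph n} (x : ℝ≥0) (F : MFlow H) :
    ∃ F' : MFlow (H.withLen x), F'.demand = F.demand ∧ F'.congestion ≤ F.congestion ∧
      F'.step ≤ F.step := by
  classical
  let f : SimplePath H → SimplePath (H.withLen x) :=
    SimplePath.map (H := H.withLen x) id (fun _ => rfl) (fun _ => rfl)
  refine ⟨Finsupp.mapDomain f F, ?_, ?_, ?_⟩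
  · funext v w
    rw [demand_eq, demand_eq, weigh_mapDomain]
    rfl
  · refine congestion_le_iff.2 fun e => le_trans (le_of_eq ?_) (F.onEdge_le e)
    refine (onEdge_eq _ _).trans ((weigh_mapDomain _ _ _).trans ((weigh_congr fun P _ => ?_).trans
      (onEdge_eq F e).symm))
    exact SimplePath.ind_map (G := H) (H := H.withLen x) (φ := id) Function.injective_id _ _ P e
  · refine step_le_iff.2 fun Q hQ => ?_
    obtain ⟨P, hP, rfl⟩ := Finset.mem_image.1 (Finsupp.mapDomain_support hQ)
    refine le_trans (le_of_eq ?_) (step_le_iff.1 le_rfl P hP)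
    exact List.length_map _

variable {G G' : CapGraph n} {lo hi δ : ℝ≥0}

lemma SimplePath.steps_le_length_stage (P : SimplePath (stage G G' lo hi δ)) :
    (P.steps : ℝ≥0) ≤ P.length := by
  have : P.darts.length • (1 : ℝ≥0) ≤ (P.darts.map fun a => (stage G G' lo hi δ).len a.1).sum := by
    have h := List.card_nsmul_le_sum (P.darts.map fun a => (stage G G' lo hi δ).len a.1) 1 (by
      intro x hx
      obtain ⟨a, -, rfl⟩ := List.mem_map.1 hx
      exact one_le_stageLen _)
    rwa [List.length_map] at h
  rwa [nsmul_eq_mul, mul_one] at this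

/-- The path in `G ∪ G'` behind a path in the stage. -/
def stagePath (P : SimplePath (stage G G' lo hi δ)) : SimplePath (G.union G') :=
  P.map stageEdge stage_src stage_dst

/-- An embedding into the stage is an embedding into `G ∪ G'` that uses only half of the
capacities. -/
lemma exists_stage_embedding {H' : CapGraph n} (E : Embedding H' (stage G G' lo hi δ))
    (hE : E.total.congestion ≤ 1) (hs : E.HasLengthSlack 1) {x y : ℝ≥0} (hy : ∀ e, H'.len e = y)
    (hx : ∀ P : SimplePath (stage G G' lo hi δ), P.length ≤ y → (stagePath P).length ≤ x) :
    ∃ E' : Embedding (H'.withLen x) (G.union G'), E'.HasLengthSlack 1 ∧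
      E'.total.congestion ≤ 1 / 2 ∧ E'.total.pathCount ≤ E.total.pathCount ∧
      (E'.total.step : ℝ≥0) ≤ y ∧
      ∀ e : Fin G.m, E'.total.onEdge (Fin.castAdd G'.m e) ≠ 0 → lo < G.len e ∧ G.len e ≤ hi := by
  classical
  have hlen : ∀ e, ∀ P ∈ (E.flow e).support, P.length ≤ y := by
    intro e P hP
    have := MFlow.leng_le_iff.1 (hs e) P hP
    rwa [hy, one_mul] at this
  let E' : Embedding (H'.withLen x) (G.union G') :=
    ⟨fun e => Finsupp.mapDomain stagePath (E.flow e), fun e Q hQ => by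
      obtain ⟨P, hP, rfl⟩ := Finset.mem_image.1 (Finsupp.mapDomain_support hQ)
      exact E.ends e P hP, fun e => by
      rw [MFlow.val_eq, MFlow.weigh_mapDomain, ← MFlow.val_eq]
      exact E.value e⟩
  have htot : E'.total = Finsupp.mapDomain stagePath E.total :=
    Finsupp.mapDomain_finsetSum.symm
  have hzero : ∀ u, E'.total.onEdge u ≠ 0 →
      ∃ z : Fin (stage G G' lo hi δ).m, stageEdge z = u := by
    intro u hu
    by_contra! h
    refine hu ?_
    rw [MFlow.onEdge_eq, htot, MFlow.weigh_mapDomain, MFlow.weigh_apply, Finset.sum_eq_zero]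
    intro P _
    rw [stagePath, SimplePath.ind_map_eq_zero _ _ _ _ h, mul_zero]
  refine ⟨E', fun e => MFlow.leng_le_iff.2 fun Q hQ => ?_, MFlow.congestion_le_iff.2 fun u => ?_,
    ?_, ?_, fun e he => ?_⟩
  · obtain ⟨P, hP, rfl⟩ := Finset.mem_image.1 (Finsupp.mapDomain_support hQ)
    refine (hx P (hlen e P hP)).trans ?_
    rw [one_mul]
    change x ≤ if 0 < x then x else 1
    split_ifs with h
    · exact le_rfl
    · exact (not_lt.1 h).trans zero_le_one
  · by_cases hu : E'.total.onEdge u = 0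
    · rw [hu]
      exact zero_le
    · obtain ⟨z, rfl⟩ := hzero u hu
      calc E'.total.onEdge (stageEdge z) = E.total.onEdge z := by
            rw [MFlow.onEdge_eq, htot, MFlow.weigh_mapDomain, MFlow.onEdge_eq]
            exact MFlow.weigh_congr fun P _ =>
              SimplePath.ind_map stageEdge_injective stage_src stage_dst P z
        _ ≤ 1 * (stage G G' lo hi δ).cap z :=
            (E.total.onEdge_le z).trans (mul_le_mul_left hE _)
        _ = 1 / 2 * (G.union G').cap (stageEdge z) := by
            rw [stage_cap]
            ring
  · rw [htot]
    exact (Finset.card_le_card Finsupp.mapDomain_support).trans Finset.card_image_le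
  · obtain h | ⟨Q, hQ, hQs⟩ : E'.total.step = 0 ∨
      ∃ Q ∈ E'.total.support, E'.total.step = Q.steps := by
      rcases E'.total.support.eq_empty_or_nonempty with h | h
      · left
        rw [MFlow.step, h, Finset.sup_empty]
        rfl
      · exact Or.inr (Finset.exists_mem_eq_sup _ h _)
    · rw [h]
      simp
    · rw [hQs]
      obtain ⟨e, he⟩ := Embedding.exists_flow_of_mem_total hQ
      obtain ⟨P, hP, rfl⟩ := Finset.mem_image.1 (Finsupp.mapDomain_support he)
      refine le_trans (le_of_eq ?_) (P.steps_le_length_stage.trans (hlen e P hP))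
      simp [stagePath, SimplePath.map, SimplePath.steps]
  · obtain ⟨z, hz⟩ := hzero _ he
    exact mem_range_of_stageEdge hz

/-! ### The sequence of emulators -/

/-- The lower end of the range of edge lengths of `G` that are new in stage `i`. -/
def emuLo (h h₀ : ℕ) : ℕ → ℕ
  | 0 => 0
  | i + 1 => h₀ * h ^ i

/-- The unit of length of stage `i`. -/
def emuUnit (h h₀ : ℕ) : ℕ → ℕ
  | 0 => 1
  | i + 1 => h₀ * h ^ i

/-- The length parameter of the call in stage `i`. -/
def emuParam (h t h₀ : ℕ) : ℕ → ℕ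
  | 0 => h₀
  | _ + 1 => (2 * t + 3) * h

/-- The length of the edges of the emulator with index `i`. -/
def emuLen (h t h₀ : ℕ) (s : ℝ≥0) (i : ℕ) : ℝ≥0 :=
  s ^ (i + 1) * (2 * (t : ℝ≥0) + 3) ^ i * ((h₀ * h ^ i : ℕ) : ℝ≥0)

/-- The emulators that bootstrapping computes: the next one is the result of the algorithm on the
stage formed by `G` and the present one, in the original lengths. -/
def emuSeq (A : CapGraph n → ℕ → CapGraph n) (G : CapGraph n) (h t h₀ : ℕ) (s : ℝ≥0) :
    ℕ → CapGraph n
  | 0 => (A (stage G (CapGraph.empty n) (emuLo h h₀ 0 : ℕ) ((h₀ * h ^ 0 : ℕ) : ℝ≥0)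
      (emuUnit h h₀ 0 : ℕ)) (emuParam h t h₀ 0)).withLen (emuLen h t h₀ s 0)
  | i + 1 => (A (stage G (emuSeq A G h t h₀ s i) (emuLo h h₀ (i + 1) : ℕ)
      ((h₀ * h ^ (i + 1) : ℕ) : ℝ≥0) (emuUnit h h₀ (i + 1) : ℕ))
      (emuParam h t h₀ (i + 1))).withLen (emuLen h t h₀ s (i + 1))

/-- The graph on which the algorithm is called in stage `i`. -/
def emuInput (A : CapGraph n → ℕ → CapGraph n) (G : CapGraph n) (h t h₀ : ℕ) (s : ℝ≥0) (i : ℕ) :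
    CapGraph n :=
  stage G (prev (emuSeq A G h t h₀ s) i) (emuLo h h₀ i : ℕ) ((h₀ * h ^ i : ℕ) : ℝ≥0)
    (emuUnit h h₀ i : ℕ)

lemma emuSeq_eq (A : CapGraph n → ℕ → CapGraph n) (G : CapGraph n) (h t h₀ : ℕ) (s : ℝ≥0) (i : ℕ) :
    emuSeq A G h t h₀ s i =
      (A (emuInput A G h t h₀ s i) (emuParam h t h₀ i)).withLen (emuLen h t h₀ s i) := by
  cases i <;> rfl

/-- The guarantees of the algorithm that is bootstrapped. -/
def IsEmulatorAlg (A : CapGraph n → ℕ → CapGraph n) (h t : ℕ) (s κ : ℝ≥0) (α : ℝ) : Prop :=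
  ∀ (H : CapGraph n) (h' : ℕ), H.Integral → 1 ≤ h' → h' ≤ (2 * t + 3) * h →
    IsEmulator H (A H h') h' t s κ ∧ ((A H h').m : ℝ) ≤ α * H.m ∧
    ∃ E : Embedding (A H h') H, E.total.congestion ≤ 1 ∧ E.HasLengthSlack 1 ∧
      (E.total.pathCount : ℝ) ≤ α * H.m

section

variable {h t h₀ : ℕ} {s κ : ℝ≥0} {α : ℝ} {A : CapGraph n → ℕ → CapGraph n}

lemma emuParam_bounds (hh₀ : 1 ≤ h₀) (hh : h₀ ≤ h) (i : ℕ) :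
    1 ≤ emuParam h t h₀ i ∧ emuParam h t h₀ i ≤ (2 * t + 3) * h := by
  cases i
  · exact ⟨hh₀, hh.trans (Nat.le_mul_of_pos_left h (by omega))⟩
  · exact ⟨Nat.mul_pos (by omega) (by omega), le_rfl⟩

lemma emuInput_spec (hh₀ : 1 ≤ h₀) (hh : h₀ ≤ h) (hA : IsEmulatorAlg A h t s κ α) (i : ℕ) :
    IsEmulator (emuInput A G h t h₀ s i) (A (emuInput A G h t h₀ s i) (emuParam h t h₀ i))
        (emuParam h t h₀ i) t s κ ∧
      ((A (emuInput A G h t h₀ s i) (emuParam h t h₀ i)).m : ℝ) ≤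
        α * (emuInput A G h t h₀ s i).m ∧
      ∃ E : Embedding (A (emuInput A G h t h₀ s i) (emuParam h t h₀ i))
        (emuInput A G h t h₀ s i), E.total.congestion ≤ 1 ∧ E.HasLengthSlack 1 ∧
          (E.total.pathCount : ℝ) ≤ α * (emuInput A G h t h₀ s i).m :=
  hA _ _ stage_integral (emuParam_bounds hh₀ hh i).1 (emuParam_bounds hh₀ hh i).2

lemma prev_emuSeq_m_le (hh₀ : 1 ≤ h₀) (hh : h₀ ≤ h) (hα : 1 < α)
    (hA : IsEmulatorAlg A h t s κ α) (i : ℕ) :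
    ((prev (emuSeq A G h t h₀ s) i).m : ℝ) ≤ (2 * α) ^ i * G.m ∧
      ((emuInput A G h t h₀ s i).m : ℝ) ≤ 2 * (2 * α) ^ i * G.m := by
  have key : ∀ i, ((prev (emuSeq A G h t h₀ s) i).m : ℝ) ≤ (2 * α) ^ i * G.m →
      ((emuInput A G h t h₀ s i).m : ℝ) ≤ 2 * (2 * α) ^ i * G.m := by
    intro i hi
    have h₁ : ((emuInput A G h t h₀ s i).m : ℝ) ≤ G.m + (prev (emuSeq A G h t h₀ s) i).m :=
      mod_cast stage_m_le
    have h₂ : (1 : ℝ) * G.m ≤ (2 * α) ^ i * G.m := by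
      gcongr
      exact one_le_pow₀ (by linarith)
    linarith
  induction i with
  | zero =>
    have : ((prev (emuSeq A G h t h₀ s) 0).m : ℝ) ≤ (2 * α) ^ 0 * G.m := by
      simp [prev, CapGraph.empty]
    exact ⟨this, key 0 this⟩
  | succ i ih =>
    have : ((prev (emuSeq A G h t h₀ s) (i + 1)).m : ℝ) ≤ (2 * α) ^ (i + 1) * G.m := by
      change ((emuSeq A G h t h₀ s i).m : ℝ) ≤ _
      rw [emuSeq_eq]
      refine (emuInput_spec hh₀ hh hA i).2.1.trans ?_
      calc α * (emuInput A G h t h₀ s i).m ≤ α * (2 * (2 * α) ^ i * G.m) := by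
            gcongr
            exact ih.2
        _ = _ := by ring
    exact ⟨this, key _ this⟩

/-- On at least two vertices, the slacks of the algorithm are at least `1`. -/
lemma IsEmulatorAlg.one_le_slacks (hA : IsEmulatorAlg A h t s κ α) (hh : 1 ≤ h) (hn : ¬ n ≤ 1) :
    1 ≤ s ∧ 1 ≤ κ := by
  have hvw : (⟨0, by omega⟩ : Fin n) ≠ ⟨1, by omega⟩ := by simp
  exact LowStep.one_le_slacks hvw (hA _ 1 (fun _ => ⟨1, by simp [edgeGraph]⟩) le_rfl
    (Nat.mul_pos (by omega) hh)).1

lemma emuLen_zero : emuLen h t h₀ s 0 = s * (emuParam h t h₀ 0 : ℕ) := by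
  simp [emuLen, emuParam]

lemma emuLen_succ (i : ℕ) :
    emuLen h t h₀ s (i + 1) = emuLen h t h₀ s i * (s * (emuParam h t h₀ (i + 1) : ℕ)) := by
  simp only [emuLen, emuParam]
  push_cast
  ring

/-- The lengths of stage `i` are not shorter than the original lengths in the appropriate unit. -/
lemma stagePath_length_le (hh₀ : 1 ≤ h₀) (hh : h₀ ≤ h) (hA : IsEmulatorAlg A h t s κ α)
    (hG : G.Integral) (i : ℕ) (P : SimplePath (emuInput A G h t h₀ s i))
    (hP : P.length ≤ s * (emuParam h t h₀ i : ℕ)) : (stagePath P).length ≤ emuLen h t h₀ s i := by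
  have key : ∀ x : ℝ≥0, (∀ z : Fin (emuInput A G h t h₀ s i).m,
      (G.union (prev (emuSeq A G h t h₀ s) i)).len (stageEdge z) ≤
        x * (emuInput A G h t h₀ s i).len z) → (stagePath P).length ≤ x * P.length := by
    intro x hx
    have : (stagePath P).length =
        (P.darts.map fun a =>
          (G.union (prev (emuSeq A G h t h₀ s) i)).len (stageEdge a.1)).sum := by
      change ((P.darts.map fun a => (stageEdge a.1, a.2)).map fun a =>
        (G.union (prev (emuSeq A G h t h₀ s) i)).len a.1).sum = _
      rw [List.map_map]
      rfl
    rw [this, SimplePath.length, ← List.sum_map_mul_left]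
    exact List.sum_le_sum fun a _ => hx a.1
  cases i with
  | zero =>
    rw [emuLen_zero]
    refine ((key 1 fun z => ?_).trans (one_mul _).le).trans hP
    rw [one_mul]
    refine le_trans ?_ (stage_len z).ge
    refine Fin.addCases (m := G.m) (n := 0) (fun e => ?_) (fun e => e.elim0) (stageEdge z)
    refine (CapGraph.union_len_left e).le.trans (le_trans ?_ (stageLen_left e).ge)
    obtain ⟨k, hk⟩ := hG e
    rw [hk]
    simp [emuUnit]
  | succ i =>
    by_cases hn : n ≤ 1
    · have : (stagePath P).length = 0 := by
        rw [SimplePath.length, SimplePath.darts_eq_nil hn]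
        rfl
      rw [this]
      exact zero_le
    · obtain ⟨hs, -⟩ := hA.one_le_slacks (hh₀.trans hh) hn
      have hu : 0 < ((h₀ * h ^ i : ℕ) : ℝ≥0) :=
        Nat.cast_pos.2 (Nat.mul_pos hh₀ (Nat.pow_pos (hh₀.trans hh)))
      have hle : ((h₀ * h ^ i : ℕ) : ℝ≥0) ≤ emuLen h t h₀ s i := by
        refine le_mul_of_one_le_left zero_le ?_
        refine one_le_mul (one_le_pow₀ hs) (one_le_pow₀ ?_)
        exact le_add_left (by norm_num)
      rw [emuLen_succ]
      refine (key (emuLen h t h₀ s i) fun z => ?_).trans (mul_le_mul_right hP _)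
      refine le_trans ?_ (mul_le_mul_right (stage_len z).ge _)
      refine Fin.addCases (m := G.m) (n := (emuSeq A G h t h₀ s i).m) (fun e => ?_) (fun e => ?_)
        (stageEdge z)
      · refine (CapGraph.union_len_left e).le.trans
          (le_trans ?_ (mul_le_mul_right (stageLen_left e).ge _))
        calc G.len e = ((h₀ * h ^ i : ℕ) : ℝ≥0) * (G.len e / ((h₀ * h ^ i : ℕ) : ℝ≥0)) :=
              (mul_div_cancel₀ _ hu.ne').symm
          _ ≤ emuLen h t h₀ s i * max 1 (⌈G.len e / ((h₀ * h ^ i : ℕ) : ℝ≥0)⌉₊ : ℝ≥0) := by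
              gcongr
              exact (Nat.le_ceil _).trans (le_max_right _ _)
      · refine (CapGraph.union_len_right e).le.trans
          (le_trans ?_ (mul_le_mul_right (stageLen_right e).ge _))
        have : (emuSeq A G h t h₀ s i).len e =
            if 0 < emuLen h t h₀ s i then emuLen h t h₀ s i else 1 := by
          cases i <;> rfl
        rw [this, if_pos (hu.trans_le hle), mul_one]

/-- A flow of length at most `h₀ * h ^ i` is routed in the input of stage `i` within the length
parameter of the call, given that the previous emulator routes shorter flows. -/
lemma exists_emuInput_flow (hh₀ : 1 ≤ h₀) (hh : h₀ ≤ h) (hκ : 1 ≤ κ) (hG : G.Integral) (i : ℕ)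
    (hfwd : ∀ j, i = j + 1 → ∀ F : MFlow G, F.leng ≤ ((h₀ * h ^ j : ℕ) : ℝ≥0) →
      ∃ F' : MFlow (emuSeq A G h t h₀ s j), F'.demand = F.demand ∧
        F'.congestion ≤ (2 * κ) ^ (j + 1) * F.congestion ∧ F'.step ≤ t)
    (F : MFlow G) (hF : F.leng ≤ ((h₀ * h ^ i : ℕ) : ℝ≥0)) :
    ∃ F' : MFlow (emuInput A G h t h₀ s i), F'.demand = F.demand ∧
      F'.congestion ≤ 2 * (2 * κ) ^ i * F.congestion ∧ F'.leng ≤ (emuParam h t h₀ i : ℕ) := by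
  have h2κ : 1 ≤ 2 * κ := by
    rw [two_mul]
    exact hκ.trans le_self_add
  have hedge : ∀ P ∈ F.support, ∀ a ∈ P.darts, G.len a.1 ≤ ((h₀ * h ^ i : ℕ) : ℝ≥0) :=
    fun P hP a ha => (List.single_le_sum (fun _ _ => zero_le) _
      (List.mem_map_of_mem (f := fun a : Fin G.m × Bool => G.len a.1) ha)).trans
        (MFlow.leng_le_iff.1 hF P hP)
  cases i with
  | zero =>
    -- all edges are long in this stage
    refine exists_stage_flow (one_le_pow₀ h2κ) (t := t) (fun F hF => ?_) F
      (fun P => P.darts.map Sum.inr) _ (fun P _ => ?_) (fun P _ => ?_) (fun P _ q hq => ?_)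
      (fun P hP a ha => ?_) fun P hP => ?_
    · obtain ⟨F', h₁, h₂, h₃⟩ := exists_flow_of_darts_eq_nil (H := prev (emuSeq A G h t h₀ s) 0) F
        (by
          intro P hP
          have h0 : P.length ≤ 0 := by simpa [emuLo] using MFlow.leng_le_iff.1 hF P hP
          by_contra hne
          obtain ⟨a, ha⟩ := List.exists_mem_of_ne_nil _ hne
          exact (((G.len_pos a.1).trans_le (List.single_le_sum (fun _ _ => zero_le) _
            (List.mem_map_of_mem (f := fun a : Fin G.m × Bool => G.len a.1) ha))).trans_le
              h0).false)
      exact ⟨F', h₁, by rw [h₂]; exact zero_le, by rw [h₃]; exact Nat.zero_le _⟩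
    · have : ∀ (l : List (Fin G.m × Bool)) (v w : Fin n), G.IsWalk v w l →
          IsChain (Seg.st (G := G)) Seg.en v w (l.map Sum.inr) := by
        intro l
        induction l with
        | nil => exact fun v w h => h
        | cons a l ih => exact fun v w h => ⟨h.1, ih _ _ h.2⟩
      exact this _ _ _ P.isWalk
    · rw [List.flatMap_map]
      simp [Seg.darts]
    · simp at hq
    · obtain ⟨b, hb, hba⟩ := List.mem_map.1 ha
      obtain rfl : b = a := by simpa using hba
      exact ⟨by simpa [emuLo] using G.len_pos b.1, hedge P hP b hb⟩
    · rw [List.map_map]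
      refine le_trans (List.sum_le_sum fun a _ => ?_)
        ((MFlow.leng_le_iff.1 hF P hP).trans_eq (by simp [emuParam]))
      refine (stageLen_left a.1).le.trans ?_
      obtain ⟨k, hk⟩ := hG a.1
      have hk1 : 1 ≤ k := by
        have := G.len_pos a.1
        rw [hk] at this
        exact_mod_cast this
      rw [hk]
      simpa [emuUnit] using hk1
  | succ i =>
    have hu : 0 < ((h₀ * h ^ i : ℕ) : ℝ≥0) :=
      Nat.cast_pos.2 (Nat.mul_pos hh₀ (Nat.pow_pos (hh₀.trans hh)))
    have hPl : ∀ P ∈ F.support, P.length ≤ h * ((h₀ * h ^ i : ℕ) : ℝ≥0) := fun P hP =>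
      (MFlow.leng_le_iff.1 hF P hP).trans_eq (by push_cast; ring)
    have hseg : ∀ P : SimplePath G, ∃ r : List (Seg G), P ∈ F.support →
        IsChain Seg.st Seg.en P.first P.last r ∧ r.flatMap Seg.darts = P.darts ∧
        (∀ p, Sum.inl p ∈ r → p.length ≤ ((h₀ * h ^ i : ℕ) : ℝ≥0)) ∧
        (∀ a, Sum.inr a ∈ r → ((h₀ * h ^ i : ℕ) : ℝ≥0) < G.len a.1) ∧
        r.countP Sum.isLeft ≤ 2 * h := by
      intro P
      by_cases hP : P ∈ F.support
      · obtain ⟨r, hr⟩ := exists_segments (hh₀.trans hh) P (hPl P hP)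
        exact ⟨r, fun _ => hr⟩
      · exact ⟨[], fun h => absurd h hP⟩
    choose items hitems using hseg
    refine exists_stage_flow (one_le_pow₀ h2κ) (hfwd i rfl) F items _
      (fun P hP => (hitems P hP).1) (fun P hP => (hitems P hP).2.1)
      (fun P hP => (hitems P hP).2.2.1) (fun P hP a ha => ⟨(hitems P hP).2.2.2.1 a ha, ?_⟩)
      fun P hP => ?_
    · refine hedge P hP a ?_
      rw [← (hitems P hP).2.1]
      exact List.mem_flatMap.2 ⟨_, ha, by simp [Seg.darts]⟩
    · obtain ⟨-, hr, -, hlong, hcount⟩ := hitems P hP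
      -- short segments cost `t` each; rounding up at most doubles the length of a long edge
      have hcost : ∀ r : List (Seg G),
          (∀ a, Sum.inr a ∈ r → ((h₀ * h ^ i : ℕ) : ℝ≥0) < G.len a.1) →
          (r.map (Sum.elim (fun _ => (t : ℝ≥0)) fun a => stageLen G (emuSeq A G h t h₀ s i)
            (emuUnit h h₀ (i + 1) : ℕ)
              (Fin.castAdd (emuSeq A G h t h₀ s i).m a.1))).sum ≤
          r.countP Sum.isLeft * (t : ℝ≥0) +
            2 * (((r.flatMap Seg.darts).map fun a => G.len a.1).sum /
              ((h₀ * h ^ i : ℕ) : ℝ≥0)) := by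
        intro r
        induction r with
        | nil => intro _; simp
        | cons x r ih =>
          intro hx
          have ih := ih fun a ha => hx a (List.mem_cons_of_mem _ ha)
          rw [List.map_cons, List.sum_cons, List.flatMap_cons, List.map_append, List.sum_append,
            add_div, mul_add]
          rcases x with q | a
          · rw [List.countP_cons_of_pos (by rfl), Nat.cast_succ, add_mul, one_mul]
            refine (add_le_add_right ih _).trans ?_
            rw [← add_assoc, Sum.elim_inl, add_comm (t : ℝ≥0)]
            exact add_le_add_right le_add_self _
          · rw [List.countP_cons_of_neg (by simp), add_left_comm]
            refine add_le_add ?_ ih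
            have ha := hx a List.mem_cons_self
            refine (stageLen_left a.1).le.trans ?_
            have h1 : 1 < G.len a.1 / ((h₀ * h ^ i : ℕ) : ℝ≥0) := (one_lt_div hu).2 ha
            simp only [Seg.darts, Sum.elim_inr, List.map_cons, List.map_nil, List.sum_cons,
              List.sum_nil, add_zero]
            refine max_le (h1.le.trans ?_) ((Nat.ceil_lt_add_one zero_le).le.trans ?_)
            · rw [two_mul]
              exact le_self_add
            · rw [two_mul]
              exact add_le_add_right h1.le _
      refine (hcost _ hlong).trans ?_
      have hL : (((items P).flatMap Seg.darts).map fun a => G.len a.1).sum /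
          ((h₀ * h ^ i : ℕ) : ℝ≥0) ≤ h := by
        rw [hr]
        exact (div_le_iff₀ hu).2 (hPl P hP)
      -- `2 * h` short segments of cost `t`, and long edges of total cost at most `2 * h`
      calc _ ≤ ((2 * h : ℕ) : ℝ≥0) * t + 2 * h := by gcongr
        _ ≤ _ := by
          rw [emuParam]
          have : 2 * h * t + 2 * h ≤ (2 * t + 3) * h := by nlinarith
          exact_mod_cast this

/-- The graphs of the sequence are emulators of `G`, with the embeddings that are asked for. -/
lemma emuSeq_spec (hh₀ : 1 ≤ h₀) (hh : h₀ ≤ h) (hA : IsEmulatorAlg A h t s κ α)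
    (hG : G.Integral) (i : ℕ) :
    IsEmulator G (emuSeq A G h t h₀ s i) (h₀ * h ^ i) t
        (s ^ (i + 1) * (2 * (t : ℝ≥0) + 3) ^ i) ((2 * κ) ^ (i + 1)) ∧
      ∃ E : Embedding (emuSeq A G h t h₀ s i) (G.union (prev (emuSeq A G h t h₀ s) i)),
        E.HasLengthSlack 1 ∧ E.total.congestion ≤ 1 / 2 ∧
        (E.total.pathCount : ℝ) ≤ α * (emuInput A G h t h₀ s i).m ∧
        (E.total.step : ℝ≥0) ≤ s * (emuParam h t h₀ i : ℕ) ∧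
        ∀ e : Fin G.m, E.total.onEdge (Fin.castAdd (prev (emuSeq A G h t h₀ s) i).m e) ≠ 0 →
          ((emuLo h h₀ i : ℕ) : ℝ≥0) < G.len e ∧ G.len e ≤ ((h₀ * h ^ i : ℕ) : ℝ≥0) := by
  induction i using Nat.strong_induction_on with
  | _ i ih =>
  obtain ⟨hem, -, E, hE, hEs, hEp⟩ := emuInput_spec (G := G) hh₀ hh hA i
  obtain ⟨hu, hf, -⟩ := isEmulator_iff.1 hem
  have hE' := exists_stage_embedding E hE hEs hu
    (stagePath_length_le hh₀ hh hA hG i)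
  rw [← emuSeq_eq] at hE'
  obtain ⟨E', h₁, h₂, h₃, h₄, h₅⟩ := hE'
  refine ⟨isEmulator_iff.2 ⟨fun e => ?_, fun F hF => ?_, ?_⟩, E', h₁, h₂,
    (Nat.cast_le.2 h₃).trans hEp, h₄, h₅⟩
  · change _ = emuLen h t h₀ s i
    have key : ∀ K, K = (A (emuInput A G h t h₀ s i) (emuParam h t h₀ i)).withLen
        (emuLen h t h₀ s i) → ∀ e : Fin K.m, K.len e = emuLen h t h₀ s i := by
      rintro K rfl e
      refine if_pos ?_
      -- if there is an edge, then its length in the result of the call shows that `s` is not zero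
      have hs : s ≠ 0 := by
        rintro rfl
        have := (A (emuInput A G h t h₀ 0 i) (emuParam h t h₀ i)).len_pos e
        rw [hu e, zero_mul] at this
        exact this.false
      have h1 : 0 < ((h₀ * h ^ i : ℕ) : ℝ≥0) :=
        Nat.cast_pos.2 (Nat.mul_pos hh₀ (Nat.pow_pos (hh₀.trans hh)))
      have h2 : (0 : ℝ≥0) < 2 * (t : ℝ≥0) + 3 := by positivity
      exact mul_pos (mul_pos (pow_pos (pos_iff_ne_zero.2 hs) _) (pow_pos h2 _)) h1
    exact key _ (emuSeq_eq ..) e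
  · by_cases hn : n ≤ 1
    · obtain ⟨F', h₁, h₂, h₃⟩ := exists_flow_of_darts_eq_nil (H := emuSeq A G h t h₀ s i) F
        fun P _ => SimplePath.darts_eq_nil hn P
      exact ⟨F', h₁, by rw [h₂]; exact zero_le, by rw [h₃]; exact Nat.zero_le _⟩
    · obtain ⟨-, hκ⟩ := hA.one_le_slacks (hh₀.trans hh) hn
      obtain ⟨F₁, hd₁, hc₁, hl₁⟩ := exists_emuInput_flow (t := t) (s := s) (A := A) hh₀ hh hκ hG i
        (fun j hj => (isEmulator_iff.1 (ih j (by omega)).1).2.1) F hF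
      obtain ⟨F₂, hd₂, hc₂, ht₂⟩ := hf F₁ hl₁
      obtain ⟨F₃, hd₃, hc₃, ht₃⟩ := F₂.exists_withLen (emuLen h t h₀ s i)
      rw [emuSeq_eq]
      refine ⟨F₃, hd₃.trans (hd₂.trans hd₁), hc₃.trans (hc₂.trans ?_), ht₃.trans ht₂⟩
      calc κ * F₁.congestion ≤ κ * (2 * (2 * κ) ^ i * F.congestion) := by gcongr
        _ = _ := by ring
  · -- replace the edges of the previous emulator by their embedding
    obtain ⟨E₀, hs₀, hc₀⟩ : ∃ E₀ : Embedding (prev (emuSeq A G h t h₀ s) i) G,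
        E₀.HasLengthSlack 1 ∧ E₀.total.congestion ≤ 1 := by
      cases i with
      | zero =>
        refine ⟨⟨fun e => e.elim0, fun e => e.elim0, fun e => e.elim0⟩, fun e => e.elim0,
          MFlow.congestion_le_iff.2 fun e => ?_⟩
        rw [Embedding.onEdge_total]
        exact (Finset.sum_eq_zero fun e _ => Fin.elim0 e).le.trans zero_le
      | succ i =>
        obtain ⟨E₀, hc₀, hs₀⟩ := (isEmulator_iff.1 (ih i (by omega)).1).2.2
        exact ⟨E₀, hs₀, hc₀⟩
    obtain ⟨E₁, hs₁, hc₁⟩ := E₀.exists_union hs₀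
    obtain ⟨E₂, hs₂, hc₂⟩ := E'.exists_comp E₁ h₁ hs₁
    refine ⟨E₂, hc₂.trans ?_, hs₂⟩
    calc E'.total.congestion * E₁.total.congestion ≤ 1 / 2 * (1 + 1) := by
          gcongr
          exact hc₁.trans (by gcongr)
      _ = 1 := by norm_num

end

end Sequence

/-! ### Straight-line programs -/

section Programs

namespace State

@[simp] lemma vec_setReg (σ : State) (r : ℕ) (x : ℝ≥0) : (σ.setReg r x).vec = σ.vec := rfl

@[simp] lemma reg_setVec (σ : State) (a : ℕ) (l : List ℝ≥0) : (σ.setVec a l).reg = σ.reg := rfl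

@[simp] lemma nat_setVec (σ : State) (a r : ℕ) (l : List ℝ≥0) : (σ.setVec a l).nat r = σ.nat r :=
  rfl

lemma reg_setReg_self (σ : State) (r : ℕ) (x : ℝ≥0) : (σ.setReg r x).reg r = x :=
  Function.update_self ..

lemma reg_setReg_of_ne (σ : State) {r r' : ℕ} (x : ℝ≥0) (h : r' ≠ r) :
    (σ.setReg r x).reg r' = σ.reg r' :=
  Function.update_of_ne h ..

lemma nat_setReg_self (σ : State) (r : ℕ) (x : ℝ≥0) : (σ.setReg r x).nat r = ⌊x⌋₊ := by
  rw [nat, reg_setReg_self]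

lemma nat_setReg_of_ne (σ : State) {r r' : ℕ} (x : ℝ≥0) (h : r' ≠ r) :
    (σ.setReg r x).nat r' = σ.nat r' := by
  rw [nat, reg_setReg_of_ne _ _ h, nat]

lemma vec_setVec_self (σ : State) (a : ℕ) (l : List ℝ≥0) : (σ.setVec a l).vec a = l :=
  Function.update_self ..

lemma vec_setVec_of_ne (σ : State) {a a' : ℕ} (l : List ℝ≥0) (h : a' ≠ a) :
    (σ.setVec a l).vec a' = σ.vec a' :=
  Function.update_of_ne h ..

lemma vecAt_eq (σ : State) (r : ℕ) : σ.vecAt r = σ.vec (σ.nat r) := rfl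

end State

/-- The state after a list of instructions. -/
def runAll : State → List Instr → State
  | σ, [] => σ
  | σ, c :: l => runAll (c.run σ) l

/-- The work of a list of instructions. -/
def workAll : State → List Instr → ℕ
  | _, [] => 0
  | σ, c :: l => c.work σ + workAll (c.run σ) l

/-- The depth of a list of instructions. -/
def depthAll : State → List Instr → ℕ
  | _, [] => 0
  | σ, c :: l => c.depth σ + depthAll (c.run σ) l

/-- A list of instructions followed by a program. -/
def block (l : List Instr) (p : Prog) : Prog := l.foldr (fun c q => .seq (.instr c) q) p

lemma exec_block {n : ℕ} {O : CapGraph n → ℕ → CapGraph n} {p : Prog} {τ : State} {w δ : ℕ}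
    {k : List (CapGraph n × ℕ)} (l : List Instr) : ∀ {σ : State},
    Exec O p (runAll σ l) τ w δ k →
    Exec O (block l p) σ τ (workAll σ l + w) (depthAll σ l + δ) k := by
  induction l with
  | nil => intro σ h; simpa [workAll, depthAll, block, runAll] using h
  | cons c l ih =>
    intro σ h
    have := Exec.seq (Exec.instr (O := O) c σ) (ih h)
    rwa [← add_assoc, ← add_assoc] at this

/-- The entries of `l` whose flag is nonzero. -/
def pack (l f : List ℝ≥0) : List ℝ≥0 :=
  ((l.zip f).filter fun p => decide (p.2 ≠ 0)).map Prod.fst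

/-! ### The bootstrapping program -/

/-- The selection of the edges of `G` with length in the range of the stage: the flags, which the
vector `5` holds in the end, are differences of comparisons. -/
def flagInstrs : List Instr :=
  [.bin .add 16 7 21, .bin .add 17 7 22, .bin .add 18 6 23, .vlen 19 23, .vfill 24 10 19,
    .vbin .le 25 23 24, .vfill 24 9 19, .vbin .le 26 23 24, .vbin .sub 25 25 26]

/-- The ends and the halved capacities of the stage. -/
def edgeInstrs : List Instr :=
  [.vpack 28 20 25, .vappend 28 28 7, .vpack 29 21 25, .vappend 29 29 16, .vpack 30 22 25,
    .vappend 30 30 17, .vlen 19 30, .vfill 24 22 19, .vbin .div 30 30 24]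

/-- The rescaled lengths of the stage. -/
def lenInstrs : List Instr :=
  [.vpack 31 23 25, .vlen 19 31, .vfill 24 11 19, .vbin .div 31 31 24, .vun .ceil 31 31,
    .vlen 19 7, .vfill 24 21 19, .vappend 31 31 24]

/-- Registers `20, …, 31` hold the addresses `0, …, 11`. -/
structure Consts (σ : State) : Prop where
  r20 : σ.reg 20 = 0
  r21 : σ.reg 21 = 1
  r22 : σ.reg 22 = 2
  r23 : σ.reg 23 = 3
  r24 : σ.reg 24 = 4
  r25 : σ.reg 25 = 5
  r26 : σ.reg 26 = 6
  r28 : σ.reg 28 = 8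
  r29 : σ.reg 29 = 9
  r30 : σ.reg 30 = 10
  r31 : σ.reg 31 = 11

lemma Consts.nat {σ : State} (h : Consts σ) : σ.nat 20 = 0 ∧ σ.nat 21 = 1 ∧ σ.nat 22 = 2 ∧
    σ.nat 23 = 3 ∧ σ.nat 24 = 4 ∧ σ.nat 25 = 5 ∧ σ.nat 26 = 6 ∧ σ.nat 28 = 8 ∧ σ.nat 29 = 9 ∧
    σ.nat 30 = 10 ∧ σ.nat 31 = 11 := by
  simp [State.nat, h.r20, h.r21, h.r22, h.r23, h.r24, h.r25, h.r26, h.r28, h.r29, h.r30, h.r31]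

lemma zipWith_replicate (f : ℝ≥0 → ℝ≥0 → ℝ≥0) (l : List ℝ≥0) (x : ℝ≥0) :
    List.zipWith f l (List.replicate l.length x) = l.map fun y => f y x := by
  induction l with
  | nil => rfl
  | cons a l ih => simp [List.replicate_succ, ih]

lemma pack_map {β : Type*} (L : List β) (f g : β → ℝ≥0) :
    pack (L.map f) (L.map g) = (L.filter fun x => decide (g x ≠ 0)).map f := by
  rw [pack, List.zip_map', List.filter_map, List.map_map]
  rfl

lemma length_pack_le (l f : List ℝ≥0) : (pack l f).length ≤ l.length := by
  rw [pack, List.length_map]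
  refine (List.length_filter_le _ _).trans ?_
  rw [List.length_zip]
  exact min_le_left _ _

/-- The flags that `flagInstrs` computes. -/
def flags (l : List ℝ≥0) (lo hi : ℝ≥0) : List ℝ≥0 :=
  l.map fun x => BinOp.sub.eval (BinOp.le.eval x hi) (BinOp.le.eval x lo)

lemma run_flagInstrs {σ : State} (hc : Consts σ) :
    (runAll σ flagInstrs).vec 5 = flags (σ.vec 3) (σ.reg 9) (σ.reg 10) ∧
      (∀ a, a ≠ 4 → a ≠ 5 → a ≠ 6 → (runAll σ flagInstrs).vec a = σ.vec a) ∧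
      (∀ r, r < 16 ∨ 19 < r → (runAll σ flagInstrs).reg r = σ.reg r) ∧
      (runAll σ flagInstrs).reg 16 = σ.reg 7 + 1 ∧
      (runAll σ flagInstrs).reg 17 = σ.reg 7 + 2 ∧
      (runAll σ flagInstrs).reg 18 = σ.reg 6 + 3 ∧
      workAll σ flagInstrs ≤ 100 * ((σ.vec 3).length + 1) ∧ depthAll σ flagInstrs ≤ 100 := by
  obtain ⟨n20, n21, n22, n23, n24, n25, n26, n28, n29, n30, n31⟩ := hc.nat
  refine ⟨?_, fun a h₁ h₂ h₃ => ?_, fun r hr => ?_, ?_, ?_, ?_, ?_, ?_⟩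
  all_goals
    simp (disch := omega) [flagInstrs, runAll, workAll, depthAll, Instr.run, Instr.work,
      Instr.depth, State.vecAt_eq, State.reg_setReg_self, State.reg_setReg_of_ne,
      State.nat_setReg_self, State.nat_setReg_of_ne, State.vec_setVec_self,
      State.vec_setVec_of_ne, n23, n24, n25, n26, hc.r21, hc.r22, hc.r23, zipWith_replicate,
      BinOp.eval, flags]
  omega

lemma run_vpack (σ : State) (a b c : ℕ) :
    (Instr.vpack a b c).run σ = σ.setVec (σ.nat a) (pack (σ.vecAt b) (σ.vecAt c)) := rfl

lemma run_edgeInstrs {σ : State} (hc : Consts σ) {q : ℕ} (hq : 12 ≤ q) (h₇ : σ.nat 7 = q)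
    (h₁₆ : σ.nat 16 = q + 1) (h₁₇ : σ.nat 17 = q + 2) :
    (runAll σ edgeInstrs).vec 8 = pack (σ.vec 0) (σ.vec 5) ++ σ.vec q ∧
      (runAll σ edgeInstrs).vec 9 = pack (σ.vec 1) (σ.vec 5) ++ σ.vec (q + 1) ∧
      (runAll σ edgeInstrs).vec 10 =
        (pack (σ.vec 2) (σ.vec 5) ++ σ.vec (q + 2)).map (fun x => x / 2) ∧
      (∀ a, a ≠ 4 → a < 8 ∨ 11 < a → (runAll σ edgeInstrs).vec a = σ.vec a) ∧
      (∀ r, r ≠ 19 → (runAll σ edgeInstrs).reg r = σ.reg r) ∧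
      (∀ M M', (σ.vec 0).length = M → (σ.vec 1).length = M → (σ.vec 2).length = M →
        (σ.vec 5).length = M → (σ.vec q).length = M' → (σ.vec (q + 1)).length = M' →
        (σ.vec (q + 2)).length = M' →
        workAll σ edgeInstrs ≤ 100 * (M + M' + 1) ∧
        depthAll σ edgeInstrs ≤ 100 * (1 + Nat.clog 2 (M + M))) := by
  obtain ⟨n20, n21, n22, n23, n24, n25, n26, n28, n29, n30, n31⟩ := hc.nat
  refine ⟨?_, ?_, ?_, fun a h₁ h₂ => ?_, fun r hr => ?_, fun M M' m₀ m₁ m₂ m₅ m₆ m₇ m₈ => ?_⟩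
  all_goals
    simp (disch := omega) only [edgeInstrs, runAll, workAll, depthAll, ↓run_vpack, Instr.run,
      Instr.work, Instr.depth, State.vecAt_eq, State.vec_setReg, State.reg_setVec, State.nat_setVec,
      State.reg_setReg_of_ne, State.nat_setReg_self, State.nat_setReg_of_ne, State.vec_setVec_self,
      State.vec_setVec_of_ne, n20, n21, n22, n24, n25, n28, n29, n30, h₇, h₁₆,
      h₁₇, hc.r22, zipWith_replicate, Nat.floor_natCast]
  · rfl
  · have l₀ := length_pack_le (σ.vec 0) (σ.vec 5)
    have l₁ := length_pack_le (σ.vec 1) (σ.vec 5)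
    have l₂ := length_pack_le (σ.vec 2) (σ.vec 5)
    simp only [List.length_append, List.length_replicate, m₀, m₁, m₂, m₅, m₆, m₇, m₈] at *
    constructor <;> omega

lemma run_lenInstrs {σ : State} (hc : Consts σ) {q : ℕ} (hq : 12 ≤ q) (h₇ : σ.nat 7 = q) :
    (runAll σ lenInstrs).vec 11 =
        (pack (σ.vec 3) (σ.vec 5)).map (fun x => (⌈x / σ.reg 11⌉₊ : ℝ≥0)) ++
          List.replicate (σ.vec q).length 1 ∧
      (∀ a, a ≠ 4 → a ≠ 11 → (runAll σ lenInstrs).vec a = σ.vec a) ∧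
      (∀ r, r ≠ 19 → (runAll σ lenInstrs).reg r = σ.reg r) ∧
      (∀ M M', (σ.vec 3).length = M → (σ.vec 5).length = M → (σ.vec q).length = M' →
        workAll σ lenInstrs ≤ 100 * (M + M' + 1) ∧
        depthAll σ lenInstrs ≤ 100 * (1 + Nat.clog 2 (M + M))) := by
  obtain ⟨n20, n21, n22, n23, n24, n25, n26, n28, n29, n30, n31⟩ := hc.nat
  refine ⟨?_, fun a h₁ h₂ => ?_, fun r hr => ?_, fun M M' m₃ m₅ m₆ => ?_⟩
  all_goals
    simp (disch := omega) only [lenInstrs, runAll, workAll, depthAll, ↓run_vpack, Instr.run,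
      Instr.work, Instr.depth, State.vecAt_eq, State.vec_setReg, State.reg_setVec, State.nat_setVec,
      State.reg_setReg_of_ne, State.nat_setReg_self, State.nat_setReg_of_ne, State.vec_setVec_self,
      State.vec_setVec_of_ne, n23, n24, n25, n31, h₇, hc.r21,
      zipWith_replicate, Nat.floor_natCast, List.map_map]
  · rfl
  · have l₃ := length_pack_le (σ.vec 3) (σ.vec 5)
    simp only [List.length_map, List.length_replicate, m₃, m₅, m₆] at *
    constructor <;> omega

/-- The common length of the new emulator is stored, and the parameters of the next stage are
computed. The prior range `(lo, hi]` becomes `(hi, hi * h]`. -/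
def nextInstrs : List Instr :=
  [.vfill 18 13 21, .bin .mul 9 10 21, .bin .mul 11 10 21, .bin .mul 10 10 0, .bin .mul 12 14 21,
    .bin .mul 13 13 15, .bin .add 6 6 24, .bin .add 7 7 24]

lemma run_nextInstrs {σ : State} (hc : Consts σ) :
    (runAll σ nextInstrs).vec (σ.nat 18) = [σ.reg 13] ∧
      (∀ a, a ≠ σ.nat 18 → (runAll σ nextInstrs).vec a = σ.vec a) ∧
      (∀ r, r < 6 ∨ r = 8 ∨ 13 < r → (runAll σ nextInstrs).reg r = σ.reg r) ∧
      (runAll σ nextInstrs).reg 9 = σ.reg 10 ∧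
      (runAll σ nextInstrs).reg 11 = σ.reg 10 ∧
      (runAll σ nextInstrs).reg 10 = σ.reg 10 * σ.reg 0 ∧
      (runAll σ nextInstrs).reg 12 = σ.reg 14 ∧
      (runAll σ nextInstrs).reg 13 = σ.reg 13 * σ.reg 15 ∧
      (runAll σ nextInstrs).reg 6 = σ.reg 6 + 4 ∧
      (runAll σ nextInstrs).reg 7 = σ.reg 7 + 4 ∧
      workAll σ nextInstrs ≤ 100 ∧ depthAll σ nextInstrs ≤ 100 := by
  obtain ⟨n20, n21, n22, n23, n24, n25, n26, n28, n29, n30, n31⟩ := hc.nat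
  refine ⟨?_, fun a ha => ?_, fun r hr => ?_, ?_, ?_, ?_, ?_, ?_, ?_, ?_, ?_, ?_⟩
  all_goals
    simp (disch := omega) [nextInstrs, runAll, workAll, depthAll, Instr.run,
      Instr.work, Instr.depth, State.reg_setReg_self, State.reg_setReg_of_ne,
      State.vec_setVec_self, State.vec_setVec_of_ne, n21, hc.r21, hc.r24, BinOp.eval]

/-- The constants, and the parameters of the first stage. The results are stored from the address
`16` on, and the address `12` serves as the empty predecessor of the first result. -/
def initInstrs : List Instr :=
  [.const 20 0, .const 21 1, .const 22 2, .const 23 3, .const 24 4, .const 25 5, .const 26 6,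
    .const 28 8, .const 29 9, .const 30 10, .const 31 11, .const 6 16, .const 7 12,
    .bin .add 8 1 21, .const 9 0, .bin .mul 10 3 21, .const 11 1, .bin .mul 12 3 21,
    .bin .mul 13 4 3, .bin .mul 14 22 2, .bin .add 14 14 23, .bin .mul 14 14 0, .bin .mul 15 4 14]

lemma run_initInstrs (σ : State) :
    Consts (runAll σ initInstrs) ∧
      (runAll σ initInstrs).vec = σ.vec ∧
      (∀ r, r < 6 → (runAll σ initInstrs).reg r = σ.reg r) ∧
      (runAll σ initInstrs).reg 6 = 16 ∧
      (runAll σ initInstrs).reg 7 = 12 ∧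
      (runAll σ initInstrs).reg 8 = σ.reg 1 + 1 ∧
      (runAll σ initInstrs).reg 9 = 0 ∧
      (runAll σ initInstrs).reg 10 = σ.reg 3 ∧
      (runAll σ initInstrs).reg 11 = 1 ∧
      (runAll σ initInstrs).reg 12 = σ.reg 3 ∧
      (runAll σ initInstrs).reg 13 = σ.reg 4 * σ.reg 3 ∧
      (runAll σ initInstrs).reg 14 = (2 * σ.reg 2 + 3) * σ.reg 0 ∧
      (runAll σ initInstrs).reg 15 = σ.reg 4 * ((2 * σ.reg 2 + 3) * σ.reg 0) ∧
      workAll σ initInstrs ≤ 100 ∧ depthAll σ initInstrs ≤ 100 := by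
  refine ⟨⟨?_, ?_, ?_, ?_, ?_, ?_, ?_, ?_, ?_, ?_, ?_⟩, ?_, fun r hr => ?_, ?_, ?_, ?_, ?_, ?_, ?_,
    ?_, ?_, ?_, ?_, ?_, ?_⟩
  all_goals
    simp (disch := omega) [initInstrs, runAll, workAll, depthAll, Instr.run,
      Instr.work, Instr.depth, State.reg_setReg_self, State.reg_setReg_of_ne, BinOp.eval]

/-- One stage: the input is built and the algorithm is called on it. -/
def stageProg : Prog :=
  block flagInstrs (block edgeInstrs (block lenInstrs (.seq (.call 28 12 6)
    (block nextInstrs (.instr (.bin .sub 8 8 21))))))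

/-- Register `8` counts the remaining stages. -/
def bootProg : Prog := block initInstrs (.loop 8 stageProg)

end Programs

/-! ### Correctness of the program -/

section Correctness

variable {n : ℕ}

/-- The data of the stage are those of the selected edges of `G`, followed by those of `G'`. -/
lemma ofFn_stageEdge {G G' : CapGraph n} {lo hi δ : ℝ≥0} (f : Fin (G.union G').m → ℝ≥0) :
    List.ofFn (fun e : Fin (stage G G' lo hi δ).m => f (stageEdge e)) =
      pack (List.ofFn fun e => f (Fin.castAdd G'.m e)) (flags (List.ofFn G.len) lo hi) ++
        List.ofFn fun e => f (Fin.natAdd G.m e) := by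
  have h₁ : List.ofFn (fun e : Fin (stage G G' lo hi δ).m => f (stageEdge e)) =
      (stageEdges G G' lo hi).map f :=
    List.ext_getElem (by simp [stage]) fun i h h' => by
      simp only [List.getElem_ofFn, List.getElem_map]
      rfl
  rw [h₁, stageEdges]
  refine (List.map_append.trans (congrArg₂ _ List.map_map List.map_map)).trans ?_
  rw [flags, List.ofFn_eq_map, List.ofFn_eq_map, List.ofFn_eq_map, List.map_map, pack_map]
  congr 2
  refine List.filter_congr fun e _ => ?_
  simp only [Function.comp_apply, BinOp.eval]
  by_cases h₁ : lo < G.len e <;> by_cases h₂ : G.len e ≤ hi <;>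
    simp [h₁, h₂, not_le.2, not_lt.1]

end Correctness

section Correctness

variable {n : ℕ} {A : CapGraph n → ℕ → CapGraph n} {G : CapGraph n} {h d t h₀ : ℕ} {s : ℝ≥0}

/-- The memory in front of stage `i`. The registers hold: `6` and `7` the addresses of the emulator
to be computed and of its predecessor, `8` the number of remaining stages, `9` and `10` the range
of edge lengths, `11` the unit of length, `12` the length parameter of the call, `13` the edge
length of the emulator to be computed, `14` the length parameter of all calls but the first, and
`15` the factor between the edge lengths of consecutive emulators. -/
structure Inv (A : CapGraph n → ℕ → CapGraph n) (G : CapGraph n) (h d t h₀ : ℕ) (s : ℝ≥0) (i : ℕ)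
    (σ : State) : Prop where
  consts : Consts σ
  r0 : σ.reg 0 = h
  r6 : σ.reg 6 = (16 + 4 * i : ℕ)
  r7 : σ.reg 7 = (12 + 4 * i : ℕ)
  r8 : σ.reg 8 = (d + 1 - i : ℕ)
  r9 : σ.reg 9 = (emuLo h h₀ i : ℕ)
  r10 : σ.reg 10 = (h₀ * h ^ i : ℕ)
  r11 : σ.reg 11 = (emuUnit h h₀ i : ℕ)
  r12 : σ.reg 12 = (emuParam h t h₀ i : ℕ)
  r13 : σ.reg 13 = emuLen h t h₀ s i
  r14 : σ.reg 14 = ((2 * t + 3) * h : ℕ)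
  r15 : σ.reg 15 = s * ((2 * t + 3) * h : ℕ)
  input : σ.Holds 0 G
  prev_src : σ.vec (12 + 4 * i) =
    List.ofFn fun e => (((prev (emuSeq A G h t h₀ s) i).src e : ℕ) : ℝ≥0)
  prev_dst : σ.vec (12 + 4 * i + 1) =
    List.ofFn fun e => (((prev (emuSeq A G h t h₀ s) i).dst e : ℕ) : ℝ≥0)
  prev_cap : σ.vec (12 + 4 * i + 2) = List.ofFn (prev (emuSeq A G h t h₀ s) i).cap
  output : ∀ j < i, σ.HoldsUniform (16 + 4 * j) (emuSeq A G h t h₀ s j)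

lemma Consts.of_eq {σ τ : State} (hσ : Consts σ) (h : ∀ r, 19 < r → τ.reg r = σ.reg r) :
    Consts τ := by
  constructor <;> rw [h _ (by norm_num)]
  exacts [hσ.r20, hσ.r21, hσ.r22, hσ.r23, hσ.r24, hσ.r25, hσ.r26, hσ.r28, hσ.r29, hσ.r30, hσ.r31]

lemma inv_init : Inv A G h d t h₀ s 0 (runAll (inputState G h d t h₀ s) initInstrs) := by
  obtain ⟨hc, hv, hr, h₆, h₇, h₈, h₉, h₁₀, h₁₁, h₁₂, h₁₃, h₁₄, h₁₅, -, -⟩ :=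
    run_initInstrs (inputState G h d t h₀ s)
  refine ⟨hc, ?_, ?_, ?_, ?_, ?_, ?_, ?_, ?_, ?_, ?_, ?_, ?_, ?_, ?_, ?_, fun j hj => by omega⟩
  · rw [hr 0 (by norm_num)]
    rfl
  · rw [h₆]
    norm_num
  · rw [h₇]
    norm_num
  · rw [h₈, Nat.sub_zero, Nat.cast_succ]
    rfl
  · rw [h₉]
    simp [emuLo]
  · rw [h₁₀, pow_zero, mul_one]
    rfl
  · rw [h₁₁]
    simp [emuUnit]
  · rw [h₁₂]
    rfl
  · rw [h₁₃, emuLen_zero]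
    rfl
  · rw [h₁₄]
    push_cast
    rfl
  · rw [h₁₅]
    push_cast
    rfl
  · rw [State.Holds, hv]
    refine ⟨?_, ?_, ?_, ?_⟩ <;> simp [inputState, State.storeGraph, State.setVec]
  all_goals
    rw [hv]
    simp [inputState, State.storeGraph, State.setVec, prev, CapGraph.empty]

lemma State.nat_eq {σ : State} {r k : ℕ} (h : σ.reg r = k) : σ.nat r = k := by
  rw [State.nat, h, Nat.floor_natCast]

/-- The first part of a stage stores its input graph from the address `8` on. -/
lemma exists_exec_input (hh₀ : 1 ≤ h₀) (hh : h₀ ≤ h) {i : ℕ} {σ : State}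
    (hσ : Inv A G h d t h₀ s i σ) : ∃ σ₃ w₃ δ₃,
      (∀ p τ w δ k, Exec A p σ₃ τ w δ k →
        Exec A (block flagInstrs (block edgeInstrs (block lenInstrs p))) σ τ (w₃ + w) (δ₃ + δ) k) ∧
      σ₃.Holds 8 (emuInput A G h t h₀ s i) ∧
      Consts σ₃ ∧ σ₃.reg 18 = (16 + 4 * i + 3 : ℕ) ∧
      (∀ r, r < 16 → σ₃.reg r = σ.reg r) ∧
      (∀ a, a < 4 ∨ 11 < a → σ₃.vec a = σ.vec a) ∧
      w₃ ≤ 300 * (G.m + (prev (emuSeq A G h t h₀ s) i).m + 1) ∧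
      δ₃ ≤ 300 * (1 + Nat.clog 2 (G.m + G.m)) := by
  set G' := prev (emuSeq A G h t h₀ s) i with hG'
  have hu : 0 < (emuUnit h h₀ i : ℝ≥0) := by
    cases i
    · simp [emuUnit]
    · exact Nat.cast_pos.2 (Nat.mul_pos hh₀ (Nat.pow_pos (hh₀.trans hh)))
  obtain ⟨g₀, g₁, g₂, g₃⟩ := hσ.input
  rw [zero_add] at g₁ g₂ g₃
  -- selection of the edges
  obtain ⟨a₁, a₂, a₃, a₄, a₅, a₆, a₇, a₈⟩ := run_flagInstrs hσ.consts
  set σ₁ := runAll σ flagInstrs with hσ₁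
  have c₁ : Consts σ₁ := hσ.consts.of_eq fun r hr => a₃ r (Or.inr hr)
  have n₇ : σ₁.nat 7 = 12 + 4 * i := State.nat_eq (by rw [a₃ 7 (by norm_num), hσ.r7])
  have n₁₆ : σ₁.nat 16 = 12 + 4 * i + 1 := State.nat_eq (by rw [a₄, hσ.r7]; push_cast; rfl)
  have n₁₇ : σ₁.nat 17 = 12 + 4 * i + 2 := State.nat_eq (by rw [a₅, hσ.r7]; push_cast; rfl)
  -- ends and capacities
  obtain ⟨b₁, b₂, b₃, b₄, b₅, b₆⟩ := run_edgeInstrs c₁ (by omega) n₇ n₁₆ n₁₇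
  set σ₂ := runAll σ₁ edgeInstrs with hσ₂
  have c₂ : Consts σ₂ := c₁.of_eq fun r hr => b₅ r (by omega)
  have n₇' : σ₂.nat 7 = 12 + 4 * i := (congrArg Nat.floor (b₅ 7 (by norm_num))).trans n₇
  -- lengths
  obtain ⟨d₁, d₂, d₃, d₄⟩ := run_lenInstrs c₂ (by omega) n₇'
  set σ₃ := runAll σ₂ lenInstrs with hσ₃
  have c₃ : Consts σ₃ := c₂.of_eq fun r hr => d₃ r (by omega)
  have reg₃ : ∀ r, r < 16 → σ₃.reg r = σ.reg r := fun r hr => by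
    rw [d₃ r (by omega), b₅ r (by omega), a₃ r (by omega)]
  have vec₃ : ∀ a, a < 4 ∨ 11 < a → σ₃.vec a = σ.vec a := fun a ha => by
    rw [d₂ a (by omega) (by omega), b₄ a (by omega) (by omega),
      a₂ a (by omega) (by omega) (by omega)]
  have v₁ : ∀ a, a < 4 ∨ 11 < a → σ₁.vec a = σ.vec a := fun a ha =>
    a₂ a (by omega) (by omega) (by omega)
  have v₂ : ∀ a, a < 4 ∨ 11 < a → σ₂.vec a = σ.vec a := fun a ha => by
    rw [b₄ a (by omega) (by omega), v₁ a ha]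
  rw [g₃, hσ.r9, hσ.r10] at a₁
  have a₁' : σ₂.vec 5 = _ := (b₄ 5 (by omega) (by omega)).trans a₁
  have hH : σ₃.Holds 8 (emuInput A G h t h₀ s i) := by
    refine ⟨?_, ?_, ?_, ?_⟩
    · rw [d₂ 8 (by norm_num) (by norm_num), b₁, v₁ 0 (by norm_num), v₁ (12 + 4 * i) (by omega), a₁,
        g₀, hσ.prev_src]
      refine Eq.trans ?_ (ofFn_stageEdge fun e => (((G.union G').src e : ℕ) : ℝ≥0)).symm
      simp only [CapGraph.union_src_left, CapGraph.union_src_right]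
      rfl
    · rw [d₂ _ (by norm_num) (by norm_num), b₂, v₁ 1 (by norm_num), v₁ (12 + 4 * i + 1) (by omega), a₁,
        g₁, hσ.prev_dst]
      refine Eq.trans ?_ (ofFn_stageEdge fun e => (((G.union G').dst e : ℕ) : ℝ≥0)).symm
      simp only [CapGraph.union_dst_left, CapGraph.union_dst_right]
      rfl
    · rw [d₂ _ (by norm_num) (by norm_num), b₃, v₁ 2 (by norm_num), v₁ (12 + 4 * i + 2) (by omega), a₁,
        g₂, hσ.prev_cap]
      have := ofFn_stageEdge (G := G) (G' := G') (lo := (emuLo h h₀ i : ℕ))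
        (hi := ((h₀ * h ^ i : ℕ) : ℝ≥0)) (δ := (emuUnit h h₀ i : ℕ)) (G.union G').cap
      simp only [CapGraph.union_cap_left, CapGraph.union_cap_right] at this
      refine (congrArg (List.map fun x => x / 2) this.symm).trans ?_
      rw [List.map_ofFn]
      rfl
    · rw [d₁, v₂ 3 (by norm_num), v₂ (12 + 4 * i) (by omega), a₁', g₃, hσ.prev_src,
        b₅ 11 (by norm_num), a₃ 11 (by norm_num), hσ.r11]
      refine Eq.trans ?_ (ofFn_stageEdge (stageLen G G' (emuUnit h h₀ i : ℕ))).symm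
      simp only [stageLen_left, stageLen_right]
      refine congrArg₂ _ ?_ ?_
      · rw [flags, List.ofFn_eq_map, List.ofFn_eq_map, List.map_map, pack_map, pack_map,
          List.map_map]
        refine List.map_congr_left fun e _ => (max_eq_right ?_).symm
        exact Nat.one_le_cast.2 (Nat.one_le_ceil_iff.2 (div_pos (G.len_pos e) hu))
      · rw [List.length_ofFn, List.ofFn_const]
  have l₀ : (σ.vec 0).length = G.m := by rw [g₀, List.length_ofFn]
  have l₁ : (σ.vec 1).length = G.m := by rw [g₁, List.length_ofFn]
  have l₂ : (σ.vec 2).length = G.m := by rw [g₂, List.length_ofFn]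
  have l₃ : (σ.vec 3).length = G.m := by rw [g₃, List.length_ofFn]
  have l₅ : (flags (List.ofFn G.len) (emuLo h h₀ i : ℕ) ((h₀ * h ^ i : ℕ) : ℝ≥0)).length = G.m := by
    rw [flags, List.length_map, List.length_ofFn]
  have l₆ : (σ.vec (12 + 4 * i)).length = G'.m := by rw [hσ.prev_src, List.length_ofFn]
  have l₇ : (σ.vec (12 + 4 * i + 1)).length = G'.m := by rw [hσ.prev_dst, List.length_ofFn]
  have l₈ : (σ.vec (12 + 4 * i + 2)).length = G'.m := by rw [hσ.prev_cap, List.length_ofFn]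
  obtain ⟨k₁, k₂⟩ := b₆ G.m G'.m (by rw [v₁ 0 (by norm_num), l₀]) (by rw [v₁ 1 (by norm_num), l₁])
    (by rw [v₁ 2 (by norm_num), l₂]) (by rw [a₁, l₅]) (by rw [v₁ (12 + 4 * i) (by omega), l₆])
    (by rw [v₁ (12 + 4 * i + 1) (by omega), l₇]) (by rw [v₁ (12 + 4 * i + 2) (by omega), l₈])
  obtain ⟨k₃, k₄⟩ := d₄ G.m G'.m (by rw [v₂ 3 (by norm_num), l₃]) (by rw [a₁', l₅])
    (by rw [v₂ (12 + 4 * i) (by omega), l₆])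
  rw [l₃] at a₇
  refine ⟨σ₃, workAll σ flagInstrs + (workAll σ₁ edgeInstrs + workAll σ₂ lenInstrs),
    depthAll σ flagInstrs + (depthAll σ₁ edgeInstrs + depthAll σ₂ lenInstrs),
    fun p τ w δ k hp => ?_, hH, c₃, ?_, reg₃, vec₃, by omega, by omega⟩
  · have := exec_block flagInstrs (exec_block edgeInstrs (exec_block lenInstrs hp))
    simpa only [add_assoc] using this
  · rw [d₃ 18 (by norm_num), b₅ 18 (by norm_num), a₆, hσ.r6]
    push_cast
    ring

/-- One stage stores the next emulator and restores the invariant. -/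
lemma exec_stageProg (hh₀ : 1 ≤ h₀) (hh : h₀ ≤ h) {i : ℕ} {σ : State}
    (hlen : ∀ e, (emuSeq A G h t h₀ s i).len e = emuLen h t h₀ s i)
    (hσ : Inv A G h d t h₀ s i σ) : ∃ τ w δ,
      Exec A stageProg σ τ w δ [(emuInput A G h t h₀ s i, emuParam h t h₀ i)] ∧
      Inv A G h d t h₀ s (i + 1) τ ∧
      w ≤ 1000 * (G.m + (prev (emuSeq A G h t h₀ s) i).m + 1) ∧
      δ ≤ 1000 * (1 + Nat.clog 2 (G.m + G.m)) := by
  obtain ⟨σ₃, w₃, δ₃, hexec, hH, c₃, h₁₈, reg₃, vec₃, hw, hδ⟩ := exists_exec_input hh₀ hh hσ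
  obtain ⟨g₀, g₁, g₂, g₃⟩ := hσ.input
  rw [zero_add] at g₁ g₂ g₃
  -- the call
  have n₁₂ : σ₃.nat 12 = emuParam h t h₀ i := State.nat_eq (by rw [reg₃ 12 (by norm_num), hσ.r12])
  have n₆ : σ₃.nat 6 = 16 + 4 * i := State.nat_eq (by rw [reg₃ 6 (by norm_num), hσ.r6])
  have hcall := Exec.call (O := A) (a := 28) (k := 12) (b := 6) (σ := σ₃)
    (H := emuInput A G h t h₀ s i) (by rw [c₃.nat.2.2.2.2.2.2.2.1]; exact hH)
  rw [n₁₂, n₆] at hcall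
  set B := A (emuInput A G h t h₀ s i) (emuParam h t h₀ i) with hB
  set σ₄ := σ₃.storeGraph (16 + 4 * i) B with hσ₄
  have reg₄ : σ₄.reg = σ₃.reg := rfl
  have c₄ : Consts σ₄ := c₃.of_eq fun r _ => rfl
  have n₁₈ : σ₄.nat 18 = 16 + 4 * i + 3 := State.nat_eq h₁₈
  obtain ⟨e₁, e₂, e₃, e₄, e₅, e₆, e₇, e₈, e₉, e₁₀, e₁₁, e₁₂⟩ := run_nextInstrs c₄
  rw [n₁₈] at e₁ e₂
  rw [reg₄] at e₁ e₃ e₄ e₅ e₆ e₇ e₈ e₉ e₁₀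
  set σ₅ := runAll σ₄ nextInstrs with hσ₅
  have hlast := Exec.instr (O := A) (Instr.bin .sub 8 8 21) σ₅
  set σ₆ := (Instr.bin .sub 8 8 21).run σ₅ with hσ₆
  have vec₆ : σ₆.vec = σ₅.vec := rfl
  have reg₆ : ∀ r, r ≠ 8 → σ₆.reg r = σ₅.reg r := fun r hr => State.reg_setReg_of_ne _ _ hr
  have c₅ : Consts σ₅ := c₄.of_eq fun r hr => by rw [e₃ r (by omega), reg₄]
  have c₆ : Consts σ₆ := c₅.of_eq fun r hr => reg₆ r (by omega)
  have vec₄ : ∀ a, a < 16 + 4 * i ∨ 16 + 4 * i + 3 < a → σ₄.vec a = σ₃.vec a := fun a ha => by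
    rw [hσ₄, State.storeGraph, State.vec_setVec_of_ne _ _ (by omega),
      State.vec_setVec_of_ne _ _ (by omega), State.vec_setVec_of_ne _ _ (by omega),
      State.vec_setVec_of_ne _ _ (by omega)]
  have vecK : ∀ a, a < 4 ∨ 11 < a → a < 16 + 4 * i ∨ 16 + 4 * i + 3 < a → σ₆.vec a = σ.vec a :=
    fun a ha ha' => by rw [vec₆, e₂ a (by omega), vec₄ a ha', vec₃ a ha]
  have w₀ : σ₆.vec (16 + 4 * i) = List.ofFn fun e => ((B.src e : ℕ) : ℝ≥0) := by
    rw [vec₆, e₂ _ (by omega), hσ₄, State.storeGraph, State.vec_setVec_of_ne _ _ (by omega),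
      State.vec_setVec_of_ne _ _ (by omega), State.vec_setVec_of_ne _ _ (by omega),
      State.vec_setVec_self]
  have w₁ : σ₆.vec (16 + 4 * i + 1) = List.ofFn fun e => ((B.dst e : ℕ) : ℝ≥0) := by
    rw [vec₆, e₂ _ (by omega), hσ₄, State.storeGraph, State.vec_setVec_of_ne _ _ (by omega),
      State.vec_setVec_of_ne _ _ (by omega), State.vec_setVec_self]
  have w₂ : σ₆.vec (16 + 4 * i + 2) = List.ofFn B.cap := by
    rw [vec₆, e₂ _ (by omega), hσ₄, State.storeGraph, State.vec_setVec_of_ne _ _ (by omega),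
      State.vec_setVec_self]
  have hnew : σ₆.HoldsUniform (16 + 4 * i) (emuSeq A G h t h₀ s i) := by
    refine ⟨?_, ?_, ?_, emuLen h t h₀ s i, ?_, hlen⟩
    · rw [w₀, hB, emuSeq_eq]
      rfl
    · rw [w₁, hB, emuSeq_eq]
      rfl
    · rw [w₂, hB, emuSeq_eq]
      rfl
    · rw [vec₆, e₁, reg₃ 13 (by norm_num), hσ.r13]
  have haddr : 12 + 4 * (i + 1) = 16 + 4 * i := by omega
  refine ⟨σ₆, _, _, hexec _ _ _ _ _ (.seq hcall (exec_block _ hlast)),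
    ⟨c₆, ?_, ?_, ?_, ?_, ?_, ?_, ?_, ?_, ?_, ?_, ?_, ?_, ?_, ?_, ?_, ?_⟩, ?_, ?_⟩
  · rw [reg₆ 0 (by norm_num), e₃ 0 (by norm_num), reg₃ 0 (by norm_num), hσ.r0]
  · rw [reg₆ 6 (by norm_num), e₉, reg₃ 6 (by norm_num), hσ.r6]
    push_cast
    ring
  · rw [reg₆ 7 (by norm_num), e₁₀, reg₃ 7 (by norm_num), hσ.r7]
    push_cast
    ring
  · have : σ₆.reg 8 = σ₅.reg 8 - σ₅.reg 21 := State.reg_setReg_self ..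
    rw [this, c₅.r21, e₃ 8 (by norm_num), reg₃ 8 (by norm_num), hσ.r8]
    exact (congrArg (_ - ·) Nat.cast_one.symm).trans (Nat.cast_tsub _ _).symm
  · rw [reg₆ 9 (by norm_num), e₄, reg₃ 10 (by norm_num), hσ.r10]
    rfl
  · rw [reg₆ 10 (by norm_num), e₆, reg₃ 10 (by norm_num), reg₃ 0 (by norm_num), hσ.r10, hσ.r0]
    push_cast
    ring
  · rw [reg₆ 11 (by norm_num), e₅, reg₃ 10 (by norm_num), hσ.r10]
    rfl
  · rw [reg₆ 12 (by norm_num), e₇, reg₃ 14 (by norm_num), hσ.r14]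
    rfl
  · rw [reg₆ 13 (by norm_num), e₈, reg₃ 13 (by norm_num), reg₃ 15 (by norm_num), hσ.r13, hσ.r15,
      emuLen_succ]
    rfl
  · rw [reg₆ 14 (by norm_num), e₃ 14 (by norm_num), reg₃ 14 (by norm_num), hσ.r14]
  · rw [reg₆ 15 (by norm_num), e₃ 15 (by norm_num), reg₃ 15 (by norm_num), hσ.r15]
  · rw [State.Holds, zero_add, vecK 0 (by omega) (by omega), vecK 1 (by omega) (by omega),
      vecK 2 (by omega) (by omega), zero_add, vecK 3 (by omega) (by omega)]
    exact ⟨g₀, g₁, g₂, g₃⟩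
  · rw [haddr]
    exact hnew.1
  · rw [haddr]
    exact hnew.2.1
  · rw [haddr]
    exact hnew.2.2.1
  · intro j hj
    rcases Nat.lt_succ_iff_lt_or_eq.1 hj with hj | rfl
    · rw [State.HoldsUniform, vecK _ (by omega) (by omega), vecK _ (by omega) (by omega),
        vecK _ (by omega) (by omega), vecK _ (by omega) (by omega)]
      exact hσ.output j hj
    · exact hnew
  · simp only [Instr.work]
    omega
  · simp only [Instr.depth]
    omega

lemma exec_loop (hh₀ : 1 ≤ h₀) (hh : h₀ ≤ h)
    (hlen : ∀ i e, (emuSeq A G h t h₀ s i).len e = emuLen h t h₀ s i) {W : ℝ}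
    (hW : ∀ i ≤ d, 1 + 1000 * ((G.m : ℝ) + (prev (emuSeq A G h t h₀ s) i).m + 1) ≤ W) (k : ℕ) :
    ∀ {i : ℕ} {σ : State}, i + k = d + 1 → Inv A G h d t h₀ s i σ → ∃ τ w δ calls,
      Exec A (.loop 8 stageProg) σ τ w δ calls ∧ Inv A G h d t h₀ s (d + 1) τ ∧
      calls.length = k ∧
      (∀ c ∈ calls, ∃ j ≤ d, c = (emuInput A G h t h₀ s j, emuParam h t h₀ j)) ∧
      (w : ℝ) ≤ 1 + k * W ∧ δ ≤ 1 + k * (1 + 1000 * (1 + Nat.clog 2 (G.m + G.m))) := by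
  induction k with
  | zero =>
    intro i σ hi hσ
    obtain rfl : i = d + 1 := hi
    refine ⟨σ, 1, 1, [], .loop_done ?_, hσ, rfl, by simp, by simp, by simp⟩
    rw [hσ.r8]
    simp
  | succ k ih =>
    intro i σ hi hσ
    obtain ⟨τ, w, δ, h₁, h₂, h₃, h₄⟩ := exec_stageProg hh₀ hh (hlen i) hσ
    obtain ⟨υ, w', δ', calls, h₁', h₂', h₃', h₄', h₅', h₆'⟩ := ih (by omega) h₂
    refine ⟨υ, _, _, _, .loop_step ?_ h₁ h₁', h₂', ?_, fun c hc => ?_, ?_, ?_⟩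
    · rw [hσ.r8]
      exact Nat.cast_ne_zero.2 (by omega)
    · simp [h₃']
    · rcases List.mem_append.1 hc with hc | hc
      · exact ⟨i, by omega, by simpa using hc⟩
      · exact h₄' c hc
    · have h₅ : (w : ℝ) ≤ 1000 * ((G.m : ℝ) + (prev (emuSeq A G h t h₀ s) i).m + 1) := by
        exact_mod_cast h₃
      have := hW i (by omega)
      push_cast
      linarith
    · rw [Nat.succ_mul]
      omega

lemma clog_two_mul_le (m : ℕ) : Nat.clog 2 (m + m) ≤ Nat.log 2 (m + 2) + 2 := by
  rw [Nat.clog_le_iff_le_pow (by norm_num)]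
  have := Nat.lt_pow_succ_log_self (b := 2) (by norm_num) (m + 2)
  rw [pow_succ]
  omega

end Correctness

end LowStep

end
theorem mainTheorem7 :
    ∃ (P : LowStep.Prog) (out C : ℕ),
      ∀ (n h d t h₀ : ℕ) (s κ : ℝ≥0) (α : ℝ), 1 ≤ h₀ → h₀ ≤ h → 1 < α →
      ∀ A : LowStep.CapGraph n → ℕ → LowStep.CapGraph n,
        (∀ (H : LowStep.CapGraph n) (h' : ℕ), H.Integral → 1 ≤ h' → h' ≤ (2 * t + 3) * h →
          LowStep.IsEmulator H (A H h') h' t s κ ∧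
          ((A H h').m : ℝ) ≤ α * H.m ∧
          ∃ E : LowStep.Embedding (A H h') H,
            E.total.congestion ≤ 1 ∧ E.HasLengthSlack 1 ∧
            (E.total.pathCount : ℝ) ≤ α * H.m) →
      ∀ G : LowStep.CapGraph n, G.Integral →
        ∃ (τ : LowStep.State) (work depth : ℕ) (calls : List (LowStep.CapGraph n × ℕ))
          (G' : ℕ → LowStep.CapGraph n),
          LowStep.Exec A P (LowStep.inputState G h d t h₀ s) τ work depth calls ∧
          (∀ i ≤ d,
            τ.HoldsUniform (out + 4 * i) (G' i) ∧
            LowStep.IsEmulator G (G' i) (h₀ * h ^ i) t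
              (s ^ (i + 1) * (2 * (t : ℝ≥0) + 3) ^ i) ((2 * κ) ^ (i + 1)) ∧
            ((G' i).m : ℝ) ≤ (2 * α) ^ (i + 1) * G.m ∧
            ∃ E : LowStep.Embedding (G' i) (G.union (LowStep.prev G' i)),
              E.HasLengthSlack 1 ∧
              E.total.congestion ≤ 1 ∧
              (E.total.pathCount : ℝ) ≤ (2 * α) ^ (i + 1) * G.m ∧
              (E.total.step : ℝ≥0) ≤ (2 * s * t + 3 * s) * h ∧
              ∀ e : Fin G.m, E.total.onEdge (Fin.castAdd (LowStep.prev G' i).m e) ≠ 0 →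
                (1 ≤ i → ((h₀ * h ^ (i - 1) : ℕ) : ℝ≥0) < G.len e) ∧
                G.len e ≤ ((h₀ * h ^ i : ℕ) : ℝ≥0)) ∧
          calls.length = d + 1 ∧
          (∀ c ∈ calls, c.1.Integral ∧ 1 ≤ c.2 ∧ c.2 ≤ (2 * t + 3) * h ∧
            (c.1.m : ℝ) ≤ C * ((d + 1) * (2 * α) ^ d * G.m)) ∧
          (work : ℝ) ≤ C * ((d + 1) * (2 * α) ^ d * (G.m + 1)) ∧
          depth ≤ C * ((d + 1) * Nat.log 2 (G.m + 2) ^ C) := by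
  -- the constant is kept abstract, as it also appears as an exponent
  obtain ⟨C, hC⟩ : ∃ C : ℕ, 10000 ≤ C := ⟨10000, le_rfl⟩
  have hC' : (10000 : ℝ) ≤ C := by exact_mod_cast hC
  refine ⟨LowStep.bootProg, 16, C, ?_⟩
  intro n h d t h₀ s κ α hh₀ hh hα A hA G hG
  have hspec := LowStep.emuSeq_spec hh₀ hh hA hG
  set S := LowStep.emuSeq A G h t h₀ s with hS
  have hpow : ∀ i ≤ d, (2 * α) ^ i ≤ (2 * α) ^ d := fun i hi =>
    pow_le_pow_right₀ (by linarith) hi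
  have hone : 1 ≤ (2 * α) ^ d := one_le_pow₀ (by linarith)
  have hm := fun i => LowStep.prev_emuSeq_m_le (G := G) hh₀ hh hα hA i
  have hinput : ∀ i, α * ((LowStep.emuInput A G h t h₀ s i).m : ℝ) ≤ (2 * α) ^ (i + 1) * G.m := by
    intro i
    calc _ ≤ α * (2 * (2 * α) ^ i * G.m) := by
          gcongr
          exact (hm i).2
      _ = _ := by ring
  have hW : ∀ i ≤ d, 1 + 1000 * ((G.m : ℝ) + (LowStep.prev S i).m + 1) ≤
      2001 * ((2 * α) ^ d * (G.m + 1)) := by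
    intro i hi
    have h₁ : ((LowStep.prev S i).m : ℝ) ≤ (2 * α) ^ d * G.m :=
      (hm i).1.trans (mul_le_mul_of_nonneg_right (hpow i hi) (Nat.cast_nonneg _))
    have h₂ : 1 * ((G.m : ℝ) + 1) ≤ (2 * α) ^ d * (G.m + 1) := by gcongr
    have h₃ : (0 : ℝ) ≤ G.m := Nat.cast_nonneg _
    linarith
  obtain ⟨τ, w, δ, calls, hexec, hinv, hl, hc, hw, hδ⟩ := LowStep.exec_loop (d := d) hh₀ hh
    (fun i e => (LowStep.isEmulator_iff.1 (hspec i).1).1 e) hW (d + 1) (zero_add _)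
    LowStep.inv_init
  obtain ⟨-, -, -, -, -, -, -, -, -, -, -, -, -, hiw, hiδ⟩ :=
    LowStep.run_initInstrs (LowStep.inputState G h d t h₀ s)
  refine ⟨τ, _, _, calls, S, LowStep.exec_block _ hexec, fun i hi => ⟨hinv.output i (by omega),
    (hspec i).1, (hm (i + 1)).1, ?_⟩, hl, fun c hc' => ?_, ?_, ?_⟩
  · obtain ⟨-, E, h₁, h₂, h₃, h₄, h₅⟩ := hspec i
    refine ⟨E, h₁, h₂.trans (by rw [one_div]; exact inv_le_one_of_one_le₀ one_le_two),
      h₃.trans (hinput i), h₄.trans ?_, fun e he => ⟨fun hi1 => ?_, (h₅ e he).2⟩⟩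
    · calc s * (LowStep.emuParam h t h₀ i : ℕ) ≤ s * ((2 * t + 3) * h : ℕ) := by
            gcongr
            exact (LowStep.emuParam_bounds hh₀ hh i).2
        _ = _ := by push_cast; ring
    · obtain ⟨j, rfl⟩ : ∃ j, i = j + 1 := ⟨i - 1, by omega⟩
      exact (h₅ e he).1
  · obtain ⟨j, hj, rfl⟩ := hc c hc'
    refine ⟨LowStep.stage_integral, (LowStep.emuParam_bounds hh₀ hh j).1,
      (LowStep.emuParam_bounds hh₀ hh j).2, (hm j).2.trans ?_⟩
    have h₁ : (2 * α) ^ j * G.m ≤ (2 * α) ^ d * G.m :=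
      mul_le_mul_of_nonneg_right (hpow j hj) (Nat.cast_nonneg _)
    have h₂ : 0 ≤ (2 * α) ^ d * G.m := by positivity
    have h₃ : 0 ≤ (d : ℝ) * ((2 * α) ^ d * G.m) := by positivity
    calc 2 * (2 * α) ^ j * G.m ≤ 10000 * ((d + 1) * (2 * α) ^ d * G.m) := by linarith
      _ ≤ _ := mul_le_mul_of_nonneg_right hC' (by positivity)
  · have h₁ : (1 : ℝ) ≤ (d + 1) * ((2 * α) ^ d * (G.m + 1)) :=
      one_le_mul_of_one_le_of_one_le (by simp) (one_le_mul_of_one_le_of_one_le hone (by simp))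
    have h₂ : (LowStep.workAll (LowStep.inputState G h d t h₀ s) LowStep.initInstrs : ℝ) ≤ 100 := by
      exact_mod_cast hiw
    push_cast at hw ⊢
    calc _ ≤ 10000 * ((d + 1) * (2 * α) ^ d * (G.m + 1)) := by linarith
      _ ≤ _ := mul_le_mul_of_nonneg_right hC' (by positivity)
  · have hL : 1 ≤ Nat.log 2 (G.m + 2) := Nat.log_pos (by norm_num) (by omega)
    have hclog := LowStep.clog_two_mul_le G.m
    have hpowL : Nat.log 2 (G.m + 2) ≤ Nat.log 2 (G.m + 2) ^ C :=
      Nat.le_self_pow (by omega) _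
    obtain ⟨L', hL'⟩ : ∃ L', L' = Nat.log 2 (G.m + 2) ^ C := ⟨_, rfl⟩
    rw [← hL'] at hpowL ⊢
    have h₁ : 1 + 1000 * (1 + Nat.clog 2 (G.m + G.m)) ≤ 5000 * L' := by omega
    have h₂ : (d + 1) * (1 + 1000 * (1 + Nat.clog 2 (G.m + G.m))) ≤ (d + 1) * (5000 * L') :=
      Nat.mul_le_mul_left _ h₁
    have h₃ : 1 ≤ (d + 1) * L' := Nat.mul_pos (by omega) (by omega)
    have h₄ : (d + 1) * (5000 * L') = 5000 * ((d + 1) * L') := by ring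
    calc _ ≤ 10000 * ((d + 1) * L') := by omega
      _ ≤ _ := Nat.mul_le_mul_right _ hC
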